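/- **Setting.** Let $K$ be a commutative ring, $A$ a (not necessarily commutative) $K$-algebra, and $\mathcal{A}$ a small $K$-linear monoidal category with unit object $\mathbb{I}$, whose tensor product is $K$-linear in both variables. Write $T_{PQ}=\mathrm{Hom}_{\mathcal{A}}(P,Q)$, $T_P=T_{PP}$. Assume that $\mathcal{A}$ is a Penrose category: for every $f\in T_{PQ}$ and every $t\in T_{\mathbb{I}}$ the morphisms $t\otimes f$ and $f\otimes t$ coincide under the unit constraints. Let $\omega:\mathcal{A}\to{}_A\mathsf{Mod}_A$ be a faithful $K$-linear (strong) monoidal functor into the category of $K$-central $A$-bimodules with tensor product $\otimes_A$, such that every $\omega(P)$ is finitely generated and projective as a right $A$-module. For a bimodule $X$ put $X^*=\mathrm{Hom}_A(X_A,A_A)$, with $(b\varphi a)(x)=b\,\varphi(ax)$. The constraint $\omega(\mathbb{I})\cong A$ makes $A$ an algebra over the commutative ring $T_{\mathbb{I}}$ via $t\mapsto \omega(t)(1)$. Let $$\mathscr{R}(\mathcal{A})=\Big(\bigoplus_{P\in\mathcal{A}}\omega(P)^*\otimes_{T_P}\omega(P)\Big)\Big/\big\langle q^*\otimes \omega(t)(p)-(q^*\circ\omega(t))\otimes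 p \;:\; t\in T_{PQ},\ q^*\in\omega(Q)^*,\ p\in\omega(P)\big\rangle$$ be the infinite comatrix coring of $\omega$; write $\overline{p^*\otimes p}$ for the class of $p^*\otimes p$. It is an $A$-bimodule by $a\,\overline{p^*\otimes p}\,b=\overline{ap^*\otimes pb}$, and an $A$-coring by $$\Delta(\overline{p^*\otimes p})=\sum_i\overline{p^*\otimes e_i}\otimes_A\overline{e_i^*\otimes p},\qquad \varepsilon(\overline{p^*\otimes p})=p^*(p),$$ for any finite dual basis $\{e_i,e_i^*\}$ of $\omega(P)_A$. **Proposition.** (1) The pair $(A,\mathscr{R}(\mathcal{A}))$ is a left bialgebroid over $T_{\mathbb{I}}$, with the above $\Delta$ and $\varepsilon$, with the multiplication $$\overline{p^*\otimes p}\cdot\overline{q^*\otimes q}=\overline{(q^*\star p^*)\otimes(q\otimes_A p)},\qquad (q^*\star p^*)(x\otimes_A y)=p^*(q^*(x)y),$$ where $q\otimes_Ap\in\omega(Q)\otimes_A\omega(P)\cong\omega(Q\otimes P)$, and with source and target maps given by the $T_{\mathbb{I}}$-algebra map $$\eta:A\otimes_{T_{\mathbb{I}}}A^{o}\to\mathscr{R}(\mathcal{A}),\qquad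 \eta(a\otimes b^o)=\overline{\mathsf{l}_a\otimes b},\quad \mathsf{l}_a(r)=ar,$$ where $\omega(\mathbb{I})$ is identified with $A$, the source and target being $\mathsf{s}(a)=\eta(a\otimes1^o)$ and $\mathsf{t}(a)=\eta(1\otimes a^o)$; one has $\mathsf{s}(a)\mathsf{t}(b)v=avb$. That is: the category of left $\mathscr{R}(\mathcal{A})$-modules is monoidal and restriction of scalars along $\eta$ to $A\otimes_{T_{\mathbb{I}}}A^{o}$-modules (that is, $T_{\mathbb{I}}$-central $A$-bimodules) is strict monoidal; the action on $X\otimes_AY$ is $v(x\otimes y)=v_1x\otimes v_2y$, where $\Delta(v)=v_1\otimes_Av_2$ (sum understood), and on $A$ it is $v\,a=\varepsilon(v\,\mathsf{s}(a))$. Moreover the axioms of a left $\times_A$-bialgebra hold: $v_1\mathsf{t}(a)\otimes_A v_2=v_1\otimes_A v_2\mathsf{s}(a)$, $\Delta(vw)=v_1w_1\otimes_A v_2w_2$, $\Delta(1)=1\otimes_A1$, $\varepsilon(1)=1$ and $\varepsilon(vw)=\varepsilon(v\,\mathsf{s}(\varepsilon(w)))=\varepsilon(v\,\mathsf{t}(\varepsilon(w)))$.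 (2) Assume moreover that $A$ is commutative, that $\mathcal{A}$ is symmetric and rigid, with duals $P^\vee$ and evaluations $ev_P:P^\vee\otimes P\to\mathbb{I}$, and that $\omega$ is a symmetric monoidal functor to $A$-modules (regarded as $A$-bimodules whose two actions coincide). Then, with the structure of (1), $(A,\mathscr{R}(\mathcal{A}))$ is a commutative Hopf algebroid over $T_{\mathbb{I}}$: the algebra $\mathscr{R}(\mathcal{A})$ is commutative and there is a $T_{\mathbb{I}}$-algebra map $\mathcal{S}:\mathscr{R}(\mathcal{A})\to\mathscr{R}(\mathcal{A})$ with $\mathcal{S}\mathsf{s}=\mathsf{t}$, $\mathcal{S}\mathsf{t}=\mathsf{s}$, $v_1\mathcal{S}(v_2)=\mathsf{s}(\varepsilon(v))$, $\mathcal{S}(v_1)v_2=\mathsf{t}(\varepsilon(v))$ and $\mathcal{S}^2=\mathrm{id}$. Explicitly, $$\mathcal{S}(\overline{p^*\otimes p})=\overline{\phi_P(p)\otimes\gamma_P(p^*)},$$ where $\phi_P:\omega(P)\to\omega(P^\vee)^*$ and $\gamma_P:\omega(P)^*\to\omega(P^\vee)$ are the $A$-linear isomorphisms determined by $\phi_P(p)(y)=\langle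 y,p\rangle$ and $\langle\gamma_P(p^*),p\rangle=p^*(p)$, with $\langle-,-\rangle$ the pairing $\omega(P^\vee)\times\omega(P)\to\omega(P^\vee\otimes P)\xrightarrow{\ \omega(ev_P)\ }\omega(\mathbb{I})\cong A$. -/

import Mathlib

universe w v u

open CategoryTheory MonoidalCategory MulOpposite
open scoped TensorProduct DirectSum

/-! ### The monoidal category of bimodules over a (possibly noncommutative) algebra -/

/-- Bimodules over the `K`-algebra `A`, with `K` acting centrally.
Right actions of `A` are written as left actions of `Aᵐᵒᵖ`, so `x · a` is `op a • x`. -/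
structure BimodCat (K : Type w) (A : Type u) [CommRing K] [Ring A] [Algebra K A] where
  carrier : Type u
  [addCommGroup : AddCommGroup carrier]
  [scalarModule : Module K carrier]
  [leftModule : Module A carrier]
  [rightModule : Module Aᵐᵒᵖ carrier]
  [leftTower : IsScalarTower K A carrier]
  [rightTower : IsScalarTower K Aᵐᵒᵖ carrier]
  [smulComm : SMulCommClass A Aᵐᵒᵖ carrier]

namespace BimodCat

section Basic

variable {K : Type w} {A : Type u} [CommRing K] [Ring A] [Algebra K A]

instance : CoeSort (BimodCat.{w, u} K A) (Type u) := ⟨BimodCat.carrier⟩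

attribute [instance] addCommGroup scalarModule leftModule rightModule leftTower rightTower smulComm

/-- Maps of bimodules. -/
@[ext]
structure Hom (M N : BimodCat.{w, u} K A) where
  toLin : M →ₗ[K] N
  map_left : ∀ (a : A) (x : M), toLin (a • x) = a • toLin x
  map_right : ∀ (a : A) (x : M), toLin (op a • x) = op a • toLin x

instance : Category (BimodCat.{w, u} K A) where
  Hom M N := Hom M N
  id M := ⟨LinearMap.id, fun _ _ => rfl, fun _ _ => rfl⟩
  comp f g := ⟨g.toLin ∘ₗ f.toLin,
    fun a x => by simp [f.map_left, g.map_left], fun a x => by simp [f.map_right, g.map_right]⟩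

theorem hom_ext {M N : BimodCat.{w, u} K A} {f g : M ⟶ N}
    (h : ∀ x, f.toLin x = g.toLin x) : f = g :=
  Hom.ext (LinearMap.ext h)

@[simp] theorem id_toLin (M : BimodCat.{w, u} K A) : (𝟙 M : M ⟶ M).toLin = LinearMap.id := rfl

@[simp] theorem comp_toLin {M N P : BimodCat.{w, u} K A} (f : M ⟶ N) (g : N ⟶ P) :
    (f ≫ g).toLin = g.toLin ∘ₗ f.toLin := rfl

theorem toLin_left {M N : BimodCat.{w, u} K A} (f : M ⟶ N) (a : A) (x : M) :
    f.toLin (a • x) = a • f.toLin x := f.map_left a x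

theorem toLin_right {M N : BimodCat.{w, u} K A} (f : M ⟶ N) (a : A) (x : M) :
    f.toLin (op a • x) = op a • f.toLin x := f.map_right a x

theorem toLin_injective {M N : BimodCat.{w, u} K A} :
    Function.Injective (fun f : M ⟶ N => f.toLin) := fun _ _ h => Hom.ext h

section HomModule

variable (M N : BimodCat.{w, u} K A)

instance : Zero (M ⟶ N) := ⟨⟨0, by simp, by simp⟩⟩

instance : Add (M ⟶ N) := ⟨fun f g => ⟨f.toLin + g.toLin,
  by simp [toLin_left], by simp [toLin_right]⟩⟩

instance : Neg (M ⟶ N) := ⟨fun f => ⟨-f.toLin,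
  by simp [toLin_left], by simp [toLin_right]⟩⟩

instance : Sub (M ⟶ N) := ⟨fun f g => ⟨f.toLin - g.toLin,
  by simp [toLin_left, smul_sub], by simp [toLin_right, smul_sub]⟩⟩

instance : SMul ℕ (M ⟶ N) := ⟨fun n f => ⟨n • f.toLin,
  fun a x => by simp only [LinearMap.smul_apply, toLin_left, smul_comm n a],
  fun a x => by simp only [LinearMap.smul_apply, toLin_right, smul_comm n (op a)]⟩⟩

instance : SMul ℤ (M ⟶ N) := ⟨fun n f => ⟨n • f.toLin,
  fun a x => by simp only [LinearMap.smul_apply, toLin_left, smul_comm n a],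
  fun a x => by simp only [LinearMap.smul_apply, toLin_right, smul_comm n (op a)]⟩⟩

instance : SMul K (M ⟶ N) := ⟨fun k f => ⟨k • f.toLin,
  fun a x => by simp only [LinearMap.smul_apply, toLin_left, smul_comm k a],
  fun a x => by simp only [LinearMap.smul_apply, toLin_right, smul_comm k (op a)]⟩⟩

instance : AddCommGroup (M ⟶ N) :=
  toLin_injective.addCommGroup _ rfl (fun _ _ => rfl) (fun _ => rfl) (fun _ _ => rfl)
    (fun _ _ => rfl) (fun _ _ => rfl)

/-- The additive map sending a bimodule map to the underlying `K`-linear map. -/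
def toLinHom : (M ⟶ N) →+ (M →ₗ[K] N) where
  toFun f := f.toLin
  map_zero' := rfl
  map_add' _ _ := rfl

instance : Module K (M ⟶ N) :=
  toLin_injective.module K (toLinHom M N) (fun _ _ => rfl)

end HomModule

@[simp] theorem add_toLin {M N : BimodCat.{w, u} K A} (f g : M ⟶ N) :
    (f + g).toLin = f.toLin + g.toLin := rfl

@[simp] theorem smul_toLin {M N : BimodCat.{w, u} K A} (k : K) (f : M ⟶ N) :
    (k • f).toLin = k • f.toLin := rfl

instance : Preadditive (BimodCat.{w, u} K A) where
  add_comp _ _ _ f f' g := hom_ext fun x => by simp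
  comp_add _ _ _ f g g' := hom_ext fun x => by simp

instance : Linear K (BimodCat.{w, u} K A) where
  smul_comp _ _ _ k f g := hom_ext fun x => by simp
  comp_smul _ _ _ f k g := hom_ext fun x => by simp

/-! #### The tensor product over `A` -/

/-- The relations `m a ⊗ n = m ⊗ a n`. -/
def balanced (M N : BimodCat.{w, u} K A) : Submodule K (M ⊗[K] N) :=
  Submodule.span K
    {z | ∃ (m : M) (a : A) (n : N), z = (op a • m) ⊗ₜ[K] n - m ⊗ₜ[K] (a • n)}

/-- The underlying `K`-module of the tensor product `M ⊗_A N`. -/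
def Tensor (M N : BimodCat.{w, u} K A) : Type u := (M ⊗[K] N) ⧸ balanced M N

namespace Tensor

variable {M N P Q : BimodCat.{w, u} K A}

instance : AddCommGroup (Tensor M N) :=
  inferInstanceAs (AddCommGroup ((M ⊗[K] N) ⧸ balanced M N))

instance : Module K (Tensor M N) :=
  inferInstanceAs (Module K ((M ⊗[K] N) ⧸ balanced M N))

/-- The bilinear map `(m, n) ↦ m ⊗ n`. -/
def mk (M N : BimodCat.{w, u} K A) : M →ₗ[K] N →ₗ[K] Tensor M N :=
  (TensorProduct.mk K M N).compr₂ (balanced M N).mkQ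

/-- The element `m ⊗ n` of `M ⊗_A N`. -/
def tmul (m : M) (n : N) : Tensor M N := mk M N m n

theorem smul_tmul (m : M) (a : A) (n : N) : tmul (op a • m) n = tmul m (a • n) :=
  (Submodule.Quotient.eq _).2 (Submodule.subset_span ⟨m, a, n, rfl⟩)

theorem add_tmul (m m' : M) (n : N) : tmul (m + m') n = tmul m n + tmul m' n := by
  simp [tmul]

theorem tmul_add (m : M) (n n' : N) : tmul m (n + n') = tmul m n + tmul m n' := by
  simp [tmul]

theorem smul_tmul' (k : K) (m : M) (n : N) : tmul (k • m) n = k • tmul m n := by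
  simp [tmul]

theorem tmul_smul (k : K) (m : M) (n : N) : tmul m (k • n) = k • tmul m n := by
  simp [tmul]

/-- A balanced bilinear map factors through the tensor product. -/
def lift {X : Type*} [AddCommGroup X] [Module K X] (f : M →ₗ[K] N →ₗ[K] X)
    (h : ∀ (m : M) (a : A) (n : N), f (op a • m) n = f m (a • n)) : Tensor M N →ₗ[K] X :=
  (balanced M N).liftQ (TensorProduct.lift f) (by
    rw [balanced, Submodule.span_le]
    rintro _ ⟨m, a, n, rfl⟩
    simp [h])

@[simp] theorem lift_tmul {X : Type*} [AddCommGroup X] [Module K X] (f : M →ₗ[K] N →ₗ[K] X)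
    (h : ∀ (m : M) (a : A) (n : N), f (op a • m) n = f m (a • n)) (m : M) (n : N) :
    lift f h (tmul m n) = f m n := rfl

theorem induction {p : Tensor M N → Prop} (x : Tensor M N) (zero : p 0)
    (tmul : ∀ m n, p (tmul m n)) (add : ∀ x y, p x → p y → p (x + y)) : p x := by
  obtain ⟨z, rfl⟩ := Submodule.Quotient.mk_surjective _ x
  induction z using TensorProduct.induction_on with
  | zero => exact zero
  | tmul m n => exact tmul m n
  | add x y hx hy => exact add _ _ hx hy

theorem lin_ext {X : Type*} [AddCommGroup X] [Module K X] {f g : Tensor M N →ₗ[K] X}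
    (h : ∀ m n, f (tmul m n) = g (tmul m n)) : f = g := by
  ext x
  induction x using Tensor.induction with
  | zero => simp
  | tmul m n => exact h m n
  | add x y hx hy => simp [hx, hy]

/-- The tensor product of two bimodule maps, as a `K`-linear map. -/
def map (f : M ⟶ P) (g : N ⟶ Q) : Tensor M N →ₗ[K] Tensor P Q :=
  lift ((mk P Q).compl₁₂ f.toLin g.toLin) (fun m a n => by
    change tmul (f.toLin (op a • m)) (g.toLin n) = tmul (f.toLin m) (g.toLin (a • n))
    rw [toLin_left, toLin_right, smul_tmul])

@[simp] theorem map_tmul (f : M ⟶ P) (g : N ⟶ Q) (m : M) (n : N) :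
    map f g (tmul m n) = tmul (f.toLin m) (g.toLin n) := rfl

/-- The left action `a (m ⊗ n) = (a m) ⊗ n`. -/
def leftAct (M N : BimodCat.{w, u} K A) : A →+* Module.End K (Tensor M N) where
  toFun a := lift ((mk M N).comp (Module.toModuleEnd K (S := A) M a)) (fun m b n => by
    change tmul (a • op b • m) n = tmul (a • m) (b • n)
    rw [smul_comm a (op b), smul_tmul])
  map_one' := lin_ext fun m n => by
    change tmul ((1 : A) • m) n = tmul m n
    rw [one_smul]
  map_mul' a b := lin_ext fun m n => by
    change tmul ((a * b) • m) n = tmul (a • b • m) n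
    rw [mul_smul]
  map_zero' := lin_ext fun m n => by
    change tmul ((0 : A) • m) n = 0
    simp [tmul]
  map_add' a b := lin_ext fun m n => by
    change tmul ((a + b) • m) n = tmul (a • m) n + tmul (b • m) n
    rw [add_smul, add_tmul]

/-- The right action `(m ⊗ n) a = m ⊗ (n a)`. -/
def rightAct (M N : BimodCat.{w, u} K A) : Aᵐᵒᵖ →+* Module.End K (Tensor M N) where
  toFun a := lift ((mk M N).compl₂ (Module.toModuleEnd K (S := Aᵐᵒᵖ) N a)) (fun m b n => by
    change tmul (op b • m) (a • n) = tmul m (a • b • n)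
    rw [smul_tmul, smul_comm b a])
  map_one' := lin_ext fun m n => by
    change tmul m ((1 : Aᵐᵒᵖ) • n) = tmul m n
    rw [one_smul]
  map_mul' a b := lin_ext fun m n => by
    change tmul m ((a * b) • n) = tmul m (a • b • n)
    rw [mul_smul]
  map_zero' := lin_ext fun m n => by
    change tmul m ((0 : Aᵐᵒᵖ) • n) = 0
    simp [tmul]
  map_add' a b := lin_ext fun m n => by
    change tmul m ((a + b) • n) = tmul m (a • n) + tmul m (b • n)
    rw [add_smul, tmul_add]

instance : Module A (Tensor M N) := Module.compHom _ (leftAct M N)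

instance : Module Aᵐᵒᵖ (Tensor M N) := Module.compHom _ (rightAct M N)

theorem left_smul_tmul (a : A) (m : M) (n : N) : a • tmul m n = tmul (a • m) n := rfl

theorem right_smul_tmul (a : Aᵐᵒᵖ) (m : M) (n : N) : a • tmul m n = tmul m (a • n) := rfl

instance : IsScalarTower K A (Tensor M N) := ⟨fun k a x => by
  induction x using Tensor.induction with
  | zero => simp
  | tmul m n => rw [left_smul_tmul, left_smul_tmul, smul_assoc, smul_tmul']
  | add x y hx hy => rw [smul_add, smul_add, smul_add, hx, hy]⟩

instance : IsScalarTower K Aᵐᵒᵖ (Tensor M N) := ⟨fun k a x => by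
  induction x using Tensor.induction with
  | zero => simp
  | tmul m n => rw [right_smul_tmul, right_smul_tmul, smul_assoc, tmul_smul]
  | add x y hx hy => rw [smul_add, smul_add, smul_add, hx, hy]⟩

instance : SMulCommClass A Aᵐᵒᵖ (Tensor M N) := ⟨fun a b x => by
  induction x using Tensor.induction with
  | zero => simp
  | tmul m n => rfl
  | add x y hx hy => simp only [smul_add, hx, hy]⟩

end Tensor

/-- The tensor product `M ⊗_A N` as a bimodule. -/
abbrev tensor (M N : BimodCat.{w, u} K A) : BimodCat.{w, u} K A := BimodCat.mk (Tensor M N)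

/-- The regular bimodule `A`. -/
abbrev unit (K : Type w) (A : Type u) [CommRing K] [Ring A] [Algebra K A] : BimodCat.{w, u} K A :=
  BimodCat.mk A

/-- A linear map out of a tensor product which is left and right `A`-linear on the elements
`m ⊗ n` is a map of bimodules. -/
def homOfTensor {M N P : BimodCat.{w, u} K A} (f : Tensor M N →ₗ[K] P)
    (hl : ∀ (a : A) (m : M) (n : N), f (Tensor.tmul (a • m) n) = a • f (Tensor.tmul m n))
    (hr : ∀ (a : A) (m : M) (n : N), f (Tensor.tmul m (op a • n)) = op a • f (Tensor.tmul m n)) :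
    tensor M N ⟶ P where
  toLin := f
  map_left a x := by
    induction x using Tensor.induction with
    | zero => rw [smul_zero, map_zero, smul_zero]
    | tmul m n => exact hl a m n
    | add x y hx hy => rw [smul_add, map_add, map_add, smul_add, hx, hy]
  map_right a x := by
    induction x using Tensor.induction with
    | zero => rw [smul_zero, map_zero, smul_zero]
    | tmul m n => exact hr a m n
    | add x y hx hy => rw [smul_add, map_add, map_add, smul_add, hx, hy]

theorem tensor_hom_ext {M N P : BimodCat.{w, u} K A} {f g : tensor M N ⟶ P}
    (h : ∀ m n, f.toLin (Tensor.tmul m n) = g.toLin (Tensor.tmul m n)) : f = g :=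
  Hom.ext (Tensor.lin_ext h)

theorem tensor_hom_ext_left {M N P Q : BimodCat.{w, u} K A} {f g : tensor (tensor M N) P ⟶ Q}
    (h : ∀ m n p, f.toLin (Tensor.tmul (Tensor.tmul m n : tensor M N) p) =
      g.toLin (Tensor.tmul (Tensor.tmul m n : tensor M N) p)) : f = g := by
  refine tensor_hom_ext fun x p => ?_
  have := Tensor.lin_ext (f := f.toLin ∘ₗ (Tensor.mk (tensor M N) P).flip p)
    (g := g.toLin ∘ₗ (Tensor.mk (tensor M N) P).flip p) (fun m n => h m n p)
  exact LinearMap.congr_fun this x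

theorem tensor_hom_ext_right {M N P Q : BimodCat.{w, u} K A} {f g : tensor M (tensor N P) ⟶ Q}
    (h : ∀ m n p, f.toLin (Tensor.tmul m (Tensor.tmul n p : tensor N P)) =
      g.toLin (Tensor.tmul m (Tensor.tmul n p : tensor N P))) : f = g := by
  refine tensor_hom_ext fun m x => ?_
  have := Tensor.lin_ext (f := f.toLin ∘ₗ Tensor.mk M (tensor N P) m)
    (g := g.toLin ∘ₗ Tensor.mk M (tensor N P) m) (fun n p => h m n p)
  exact LinearMap.congr_fun this x

/-- The tensor product of two maps of bimodules. -/
def tensorMap {M N P Q : BimodCat.{w, u} K A} (f : M ⟶ P) (g : N ⟶ Q) :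
    tensor M N ⟶ tensor P Q :=
  homOfTensor (P := tensor P Q) (Tensor.map f g)
    (fun a m n => congrArg (fun z => Tensor.tmul z (g.toLin n)) (toLin_left f a m))
    (fun a m n => congrArg (Tensor.tmul (f.toLin m)) (toLin_right g a n))

section Associator

variable (M N P : BimodCat.{w, u} K A)

/-- For fixed `m` and `n`, the map `p ↦ m ⊗ (n ⊗ p)`. -/
def assocAux : M →ₗ[K] N →ₗ[K] P →ₗ[K] Tensor M (tensor N P) :=
  LinearMap.mk₂ K (fun m n => (Tensor.mk M (tensor N P) m) ∘ₗ (Tensor.mk N P n))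
    (fun m m' n => LinearMap.ext fun p => Tensor.add_tmul (N := tensor N P) m m' (Tensor.tmul n p))
    (fun c m n => LinearMap.ext fun p => Tensor.smul_tmul' (N := tensor N P) c m (Tensor.tmul n p))
    (fun m n n' => LinearMap.ext fun p =>
      (congrArg (Tensor.tmul (N := tensor N P) m) (Tensor.add_tmul n n' p)).trans
        (Tensor.tmul_add (N := tensor N P) m _ _))
    (fun c m n => LinearMap.ext fun p =>
      (congrArg (Tensor.tmul (N := tensor N P) m) (Tensor.smul_tmul' c n p)).trans
        (Tensor.tmul_smul (N := tensor N P) c m _))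

/-- For fixed `n` and `p`, the map `m ↦ (m ⊗ n) ⊗ p`. -/
def assocInvAux : N →ₗ[K] P →ₗ[K] M →ₗ[K] Tensor (tensor M N) P :=
  LinearMap.mk₂ K (fun n p => (Tensor.mk (tensor M N) P).flip p ∘ₗ (Tensor.mk M N).flip n)
    (fun n n' p => LinearMap.ext fun m =>
      (congrArg (fun z => Tensor.tmul (M := tensor M N) z p) (Tensor.tmul_add m n n')).trans
        (Tensor.add_tmul (M := tensor M N) _ _ p))
    (fun c n p => LinearMap.ext fun m =>
      (congrArg (fun z => Tensor.tmul (M := tensor M N) z p) (Tensor.tmul_smul c m n)).trans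
        (Tensor.smul_tmul' (M := tensor M N) c _ p))
    (fun n p p' => LinearMap.ext fun m =>
      Tensor.tmul_add (M := tensor M N) (Tensor.tmul m n) p p')
    (fun c n p => LinearMap.ext fun m =>
      Tensor.tmul_smul (M := tensor M N) c (Tensor.tmul m n) p)

/-- `(m ⊗ n) ⊗ p ↦ m ⊗ (n ⊗ p)` as a linear map. -/
def assocLin : Tensor (tensor M N) P →ₗ[K] Tensor M (tensor N P) :=
  Tensor.lift (M := tensor M N)
    (Tensor.lift (assocAux M N P)
      (fun m a n => LinearMap.ext fun p =>
        Tensor.smul_tmul (N := tensor N P) m a (Tensor.tmul n p)))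
    (fun x a p => by
      induction x using Tensor.induction with
      | zero => rw [smul_zero, map_zero]; rfl
      | tmul m n =>
        exact congrArg (Tensor.tmul (N := tensor N P) m) (Tensor.smul_tmul n a p)
      | add x y hx hy => rw [smul_add, map_add, map_add, LinearMap.add_apply,
          LinearMap.add_apply, hx, hy])

/-- `m ⊗ (n ⊗ p) ↦ (m ⊗ n) ⊗ p` as a linear map. -/
def assocInvLin : Tensor M (tensor N P) →ₗ[K] Tensor (tensor M N) P :=
  Tensor.lift (N := tensor N P)
    (Tensor.lift (assocInvAux M N P)
      (fun n a p => LinearMap.ext fun m =>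
        Tensor.smul_tmul (M := tensor M N) (Tensor.tmul m n) a p)).flip
    (fun m a x => by
      induction x using Tensor.induction with
      | zero => rw [smul_zero, map_zero, map_zero]
      | tmul n p =>
        exact congrArg (fun z => Tensor.tmul (M := tensor M N) z p) (Tensor.smul_tmul m a n)
      | add x y hx hy => rw [smul_add, map_add, map_add, hx, hy])

/-- The associativity isomorphism of the tensor product over `A`. -/
def assoc : tensor (tensor M N) P ≅ tensor M (tensor N P) where
  hom := homOfTensor (M := tensor M N) (P := tensor M (tensor N P)) (assocLin M N P)
    (fun a x p => by
      induction x using Tensor.induction with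
      | zero => rw [smul_zero]; simp [Tensor.tmul]
      | tmul m n => rfl
      | add x y hx hy =>
        rw [smul_add, Tensor.add_tmul, Tensor.add_tmul, map_add, map_add, smul_add, hx, hy])
    (fun a x p => by
      induction x using Tensor.induction with
      | zero => simp [Tensor.tmul]
      | tmul m n => rfl
      | add x y hx hy =>
        rw [Tensor.add_tmul, Tensor.add_tmul, map_add, map_add, smul_add, hx, hy])
  inv := homOfTensor (N := tensor N P) (P := tensor (tensor M N) P) (assocInvLin M N P)
    (fun a m x => by
      induction x using Tensor.induction with
      | zero => simp [Tensor.tmul]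
      | tmul n p => rfl
      | add x y hx hy =>
        rw [Tensor.tmul_add, Tensor.tmul_add, map_add, map_add, smul_add, hx, hy])
    (fun a m x => by
      induction x using Tensor.induction with
      | zero => rw [smul_zero]; simp [Tensor.tmul]
      | tmul n p => rfl
      | add x y hx hy =>
        rw [smul_add, Tensor.tmul_add, Tensor.tmul_add, map_add, map_add, smul_add, hx, hy])
  hom_inv_id := tensor_hom_ext_left fun _ _ _ => rfl
  inv_hom_id := tensor_hom_ext_right fun _ _ _ => rfl

end Associator

/-- The isomorphism `A ⊗_A M ≅ M`, `a ⊗ m ↦ a m`. -/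
def leftUnit (M : BimodCat.{w, u} K A) : tensor (unit K A) M ≅ M where
  hom := homOfTensor
    (Tensor.lift (M := unit K A) (Algebra.lsmul K K M).toLinearMap
      (fun (b : A) a m => mul_smul b a m))
    (fun (a : A) (b : A) m => mul_smul a b m)
    (fun a (b : A) m => smul_comm b (op a) m)
  inv := 
    { toLin := Tensor.mk (unit K A) M (1 : A)
      map_left := fun a x => by
        refine (Tensor.smul_tmul (M := unit K A) (1 : A) a x).symm.trans ?_
        change Tensor.tmul (M := unit K A) ((1 : A) * a) x = Tensor.tmul (M := unit K A) (a * (1 : A)) x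
        rw [one_mul, mul_one]
      map_right := fun a x => rfl }
  hom_inv_id := tensor_hom_ext fun (a : A) m => by
    refine (Tensor.smul_tmul (M := unit K A) (1 : A) a m).symm.trans ?_
    exact congrArg (fun z => Tensor.tmul (M := unit K A) z m) (one_mul a)
  inv_hom_id := hom_ext fun m => one_smul A m

/-- The isomorphism `M ⊗_A A ≅ M`, `m ⊗ a ↦ m a`. -/
def rightUnit (M : BimodCat.{w, u} K A) : tensor M (unit K A) ≅ M where
  hom := homOfTensor
    (Tensor.lift (N := unit K A) ((Algebra.lsmul (A := Aᵐᵒᵖ) K K M).toLinearMap ∘ₗ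
        (opLinearEquiv K : A ≃ₗ[K] Aᵐᵒᵖ).toLinearMap).flip
      (fun m a (b : A) => (mul_smul (op b) (op a) m).symm))
    (fun a m (b : A) => (smul_comm a (op b) m).symm)
    (fun a m (b : A) => mul_smul (op a) (op b) m)
  inv :=
    { toLin := (Tensor.mk M (unit K A)).flip (1 : A)
      map_left := fun a x => rfl
      map_right := fun a x => by
        refine (Tensor.smul_tmul (N := unit K A) x a (1 : A)).trans ?_
        change Tensor.tmul (N := unit K A) x (a * (1 : A)) = Tensor.tmul (N := unit K A) x ((1 : A) * a)
        rw [one_mul, mul_one] }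
  hom_inv_id := tensor_hom_ext fun m (a : A) => by
    refine (Tensor.smul_tmul (N := unit K A) m a (1 : A)).trans ?_
    exact congrArg (fun z => Tensor.tmul (N := unit K A) m z) (mul_one a)
  inv_hom_id := hom_ext fun m => one_smul Aᵐᵒᵖ m

instance : MonoidalCategoryStruct (BimodCat.{w, u} K A) where
  tensorObj := tensor
  whiskerLeft M _ _ f := tensorMap (𝟙 M) f
  whiskerRight f M := tensorMap f (𝟙 M)
  tensorHom := tensorMap
  tensorUnit := unit K A
  associator := assoc
  leftUnitor := leftUnit
  rightUnitor := rightUnit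

instance : MonoidalCategory (BimodCat.{w, u} K A) := .ofTensorHom
  (id_tensorHom_id := fun _ _ => tensor_hom_ext fun _ _ => rfl)
  (id_tensorHom := fun _ _ _ _ => rfl)
  (tensorHom_id := fun _ _ => rfl)
  (tensorHom_comp_tensorHom := fun _ _ _ _ => tensor_hom_ext fun _ _ => rfl)
  (associator_naturality := fun _ _ _ => tensor_hom_ext_left fun _ _ _ => rfl)
  (leftUnitor_naturality := fun f => tensor_hom_ext fun (a : A) m => (toLin_left f a m).symm)
  (rightUnitor_naturality := fun f => tensor_hom_ext fun m (a : A) => (toLin_right f a m).symm)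
  (pentagon := fun M N P Q => by
    refine tensor_hom_ext fun x q => ?_
    induction x using Tensor.induction with
    | zero => simp [Tensor.tmul]
    | tmul x p =>
      induction x using Tensor.induction with
      | zero => simp [Tensor.tmul]
      | tmul m n => rfl
      | add x y hx hy => rw [Tensor.add_tmul, Tensor.add_tmul, map_add, map_add, hx, hy]
    | add x y hx hy => rw [Tensor.add_tmul, map_add, map_add, hx, hy])
  (triangle := fun M N => tensor_hom_ext_left fun m (a : A) n =>
    (Tensor.smul_tmul m a n).symm)

end Basic

end BimodCat

namespace BimodCat

section Duals

variable {K : Type w} {A : Type u} [CommRing K] [Ring A] [Algebra K A]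

/-- The right dual `M* = Hom_A(M_A, A_A)`. Its left action is `(b • φ) x = b * φ x`. -/
abbrev RDual (M : BimodCat.{w, u} K A) : Type u := M →ₗ[Aᵐᵒᵖ] A

/-- The right dual as a bimodule, with the actions `(b • φ • a) x = b * φ (a • x)`. -/
def dual (M : BimodCat.{w, u} K A) : BimodCat.{w, u} K A :=
  letI act : Module Aᵐᵒᵖ (RDual M) :=
    { smul := fun a φ =>
        { toFun := fun x => φ (unop a • x)
          map_add' := fun x y => by rw [smul_add, map_add]
          map_smul' := fun b x => by
            rw [smul_comm (unop a) b x]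
            exact φ.map_smul b (unop a • x) }
      one_smul := fun φ => LinearMap.ext fun x => congrArg φ (one_smul A x)
      mul_smul := fun a b φ => LinearMap.ext fun x =>
        congrArg φ (mul_smul (unop b) (unop a) x)
      smul_zero := fun _ => rfl
      smul_add := fun _ _ _ => rfl
      add_smul := fun a b φ => LinearMap.ext fun x =>
        (congrArg φ (add_smul (unop a) (unop b) x)).trans (φ.map_add _ _)
      zero_smul := fun φ => LinearMap.ext fun x =>
        (congrArg φ (zero_smul A x)).trans φ.map_zero }
  { carrier := RDual M
    leftTower := ⟨fun k a φ => LinearMap.ext fun x => smul_assoc k a (φ x)⟩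
    rightTower := ⟨fun k a φ => LinearMap.ext fun x =>
      (congrArg φ (smul_assoc k (unop a) x)).trans
        ((φ.restrictScalars K).map_smul k (unop a • x))⟩
    smulComm := ⟨fun _ _ _ => rfl⟩ }

/-- The right `A`-linear map underlying a map of bimodules. -/
def rightLin {M N : BimodCat.{w, u} K A} (f : M ⟶ N) : M →ₗ[Aᵐᵒᵖ] N where
  toFun := f.toLin
  map_add' := map_add f.toLin
  map_smul' a x := toLin_right f (unop a) x

/-- Left multiplication `r ↦ a r`, as an element of the right dual of the regular bimodule. -/
def leftMul (K : Type w) {A : Type u} [CommRing K] [Ring A] [Algebra K A] (a : A) :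
    RDual (𝟙_ (BimodCat.{w, u} K A)) where
  toFun (r : A) := a * r
  map_add' (r s : A) := mul_add a r s
  map_smul' b (r : A) := (mul_assoc a r (unop b)).symm

/-- The linear map `x ⊗ y ↦ ψ (φ x • y)`. -/
def starLin {M N : BimodCat.{w, u} K A} (φ : RDual M) (ψ : RDual N) : Tensor M N →ₗ[K] A :=
  Tensor.lift
    (((Algebra.lsmul K K N).toLinearMap ∘ₗ φ.restrictScalars K).compr₂ (ψ.restrictScalars K))
    (fun m a n => by
      change ψ (φ (op a • m) • n) = ψ (φ m • a • n)
      have h : φ (op a • m) = φ m * a := φ.map_smul (op a) m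
      rw [h, mul_smul])

/-- For `φ ∈ M*` and `ψ ∈ N*`, the element `φ ⋆ ψ` of `(M ⊗_A N)*` given by
`(φ ⋆ ψ) (x ⊗ y) = ψ (φ x • y)`. -/
def star {M N : BimodCat.{w, u} K A} (φ : RDual M) (ψ : RDual N) : RDual (M ⊗ N) where
  toFun := starLin φ ψ
  map_add' := map_add (starLin φ ψ)
  map_smul' a x := by
    induction x using Tensor.induction with
    | zero => rw [smul_zero, map_zero, smul_zero]
    | tmul m n =>
      change ψ (φ m • a • n) = a • ψ (φ m • n)
      exact (congrArg ψ (smul_comm (φ m) a n)).trans (ψ.map_smul a (φ m • n))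
    | add x y hx hy => rw [smul_add, map_add, map_add, smul_add, hx, hy]

@[simp] theorem star_tmul {M N : BimodCat.{w, u} K A} (φ : RDual M) (ψ : RDual N) (x : M) (y : N) :
    star φ ψ (Tensor.tmul x y) = ψ (φ x • y) := rfl

end Duals

end BimodCat

open BimodCat

/-! ### Left bialgebroids and commutative Hopf algebroids -/

section Bialgebroid

variable {L : Type v} {A V : Type u} [CommRing L] [Ring A] [Algebra L A] [Ring V] [Algebra L V]

/-- The source map of an `A ⊗[L] Aᵐᵒᵖ`-ring. -/
def src (η : A ⊗[L] Aᵐᵒᵖ →ₐ[L] V) (a : A) : V := η (a ⊗ₜ[L] 1)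

/-- The target map of an `A ⊗[L] Aᵐᵒᵖ`-ring. -/
def tgt (η : A ⊗[L] Aᵐᵒᵖ →ₐ[L] V) (a : A) : V := η (1 ⊗ₜ[L] op a)

/-- An `A ⊗[L] Aᵐᵒᵖ`-ring `V` as an `A`-bimodule: `a · v · b = src a * tgt b * v`. -/
abbrev ringBimod (η : A ⊗[L] Aᵐᵒᵖ →ₐ[L] V) : BimodCat.{v, u} L A :=
  letI : Module A V :=
    Module.compHom V (η.comp Algebra.TensorProduct.includeLeft : A →ₐ[L] V).toRingHom
  letI : Module Aᵐᵒᵖ V :=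
    Module.compHom V (η.comp Algebra.TensorProduct.includeRight : Aᵐᵒᵖ →ₐ[L] V).toRingHom
  { carrier := V
    leftTower := ⟨fun l a x => by
      change η ((l • a) ⊗ₜ[L] 1) * x = l • (η (a ⊗ₜ[L] 1) * x)
      rw [← TensorProduct.smul_tmul', map_smul, smul_mul_assoc]⟩
    rightTower := ⟨fun l a x => by
      change η (1 ⊗ₜ[L] (l • a)) * x = l • (η (1 ⊗ₜ[L] a) * x)
      rw [TensorProduct.tmul_smul, map_smul, smul_mul_assoc]⟩
    smulComm := ⟨fun a b x => by
      change η (a ⊗ₜ[L] 1) * (η (1 ⊗ₜ[L] b) * x) = η (1 ⊗ₜ[L] b) * (η (a ⊗ₜ[L] 1) * x)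
      rw [← mul_assoc, ← mul_assoc, ← map_mul, ← map_mul,
        Algebra.TensorProduct.tmul_mul_tmul, Algebra.TensorProduct.tmul_mul_tmul]
      simp⟩ }

/-- The element `∑ i, x i ⊗ y i` of `V ⊗_A V`. -/
def sumTmul (η : A ⊗[L] Aᵐᵒᵖ →ₐ[L] V) {n : ℕ} (x y : Fin n → V) :
    Tensor (ringBimod η) (ringBimod η) :=
  ∑ i, Tensor.tmul (M := ringBimod η) (N := ringBimod η) (x i) (y i)

/-- A left `V`-module whose underlying `A ⊗[L] Aᵐᵒᵖ`-module, obtained by restriction of scalars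
along `η`, is the given bimodule `M`. Thus left `V`-modules are pairs of a bimodule `M` and a term
of `ModuleOver η M`. -/
structure ModuleOver (η : A ⊗[L] Aᵐᵒᵖ →ₐ[L] V) (M : BimodCat.{v, u} L A) where
  act : V →+* AddMonoid.End M
  act_base : ∀ (a b : A) (x : M), act (η (a ⊗ₜ[L] op b)) x = op b • a • x

/-- `V`-linearity of a map between the underlying bimodules of two `V`-modules. -/
def ModuleOver.IsLinear {η : A ⊗[L] Aᵐᵒᵖ →ₐ[L] V} {M N : BimodCat.{v, u} L A}
    (ρ : ModuleOver η M) (σ : ModuleOver η N) (f : M ⟶ N) : Prop :=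
  ∀ (v : V) (x : M), f.toLin (ρ.act v x) = σ.act v (f.toLin x)

/-- A monoidal structure on the category of left `V`-modules for which restriction of scalars to
`A`-bimodules is a strict monoidal functor: the tensor product over `A` of two `V`-modules and the
regular bimodule carry `V`-module structures over their given bimodule structures, tensor products
of `V`-linear maps are `V`-linear, and so are the associativity and unit constraints of
`A`-bimodules. (The coherence axioms then hold since they hold for bimodules.) -/
structure MonoidalLift (η : A ⊗[L] Aᵐᵒᵖ →ₐ[L] V) where
  tensor : ∀ {M N : BimodCat.{v, u} L A}, ModuleOver η M → ModuleOver η N → ModuleOver η (M ⊗ N)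
  unit : ModuleOver η (𝟙_ (BimodCat.{v, u} L A))
  tensorHom : ∀ {M M' N N' : BimodCat.{v, u} L A} (ρ : ModuleOver η M) (ρ' : ModuleOver η M')
    (σ : ModuleOver η N) (σ' : ModuleOver η N') (f : M ⟶ M') (g : N ⟶ N'),
    ρ.IsLinear ρ' f → σ.IsLinear σ' g → (tensor ρ σ).IsLinear (tensor ρ' σ') (f ⊗ₘ g)
  associator : ∀ {M N P : BimodCat.{v, u} L A} (ρ : ModuleOver η M) (σ : ModuleOver η N)
    (τ : ModuleOver η P),
    (tensor (tensor ρ σ) τ).IsLinear (tensor ρ (tensor σ τ)) (α_ M N P).hom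
  leftUnitor : ∀ {M : BimodCat.{v, u} L A} (ρ : ModuleOver η M),
    (tensor unit ρ).IsLinear ρ (λ_ M).hom
  rightUnitor : ∀ {M : BimodCat.{v, u} L A} (ρ : ModuleOver η M),
    (tensor ρ unit).IsLinear ρ (ρ_ M).hom

/-- A left bialgebroid structure over the `L`-algebra `A` on the `A ⊗[L] Aᵐᵒᵖ`-ring `V`.
The category of left `V`-modules is monoidal with strict monoidal restriction of scalars to
bimodules, the action on tensor products being given by `v (x ⊗ y) = v₁ x ⊗ v₂ y` and the
action on the unit object `A` by `v a = ε (v * src a)`, for an `A`-coring structure `(Δ, ε)` on `V`.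
The remaining fields are the axioms of a left `×_A`-bialgebra: `Δ` takes values in the
Sweedler-Takeuchi product and is multiplicative and unital, and `ε` is unital and satisfies
`ε (v w) = ε (v * src (ε w)) = ε (v * tgt (ε w))`. -/
structure LeftBialgebroid (η : A ⊗[L] Aᵐᵒᵖ →ₐ[L] V) where
  lift : MonoidalLift η
  coring : ComonObj (ringBimod η)
  tensor_act : ∀ {M N : BimodCat.{v, u} L A} (ρ : ModuleOver η M) (σ : ModuleOver η N) (v : V)
    {n : ℕ} (x y : Fin n → V), coring.comul.toLin v = sumTmul η x y → ∀ (m : M) (m' : N),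
    (lift.tensor ρ σ).act v (Tensor.tmul m m') =
      ∑ i, Tensor.tmul (ρ.act (x i) m) (σ.act (y i) m')
  unit_act : ∀ (v : V) (a : A), lift.unit.act v a = coring.counit.toLin (v * src η a)
  takeuchi : ∀ (v : V) {n : ℕ} (x y : Fin n → V), coring.comul.toLin v = sumTmul η x y →
    ∀ a : A, sumTmul η (fun i => x i * tgt η a) y = sumTmul η x (fun i => y i * src η a)
  comul_mul : ∀ (v v' : V) {n n' : ℕ} (x y : Fin n → V) (x' y' : Fin n' → V),
    coring.comul.toLin v = sumTmul η x y → coring.comul.toLin v' = sumTmul η x' y' →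
    coring.comul.toLin (v * v') =
      ∑ i, sumTmul η (fun j => x i * x' j) (fun j => y i * y' j)
  comul_one : coring.comul.toLin (1 : V) =
    Tensor.tmul (M := ringBimod η) (N := ringBimod η) (1 : V) (1 : V)
  counit_one : coring.counit.toLin (1 : V) = (1 : A)
  counit_mul_src : ∀ v v' : V,
    coring.counit.toLin (v * v') = coring.counit.toLin (v * src η (coring.counit.toLin v'))
  counit_mul_tgt : ∀ v v' : V,
    coring.counit.toLin (v * v') = coring.counit.toLin (v * tgt η (coring.counit.toLin v'))

/-- The left bialgebroid `(A, V)` is a commutative Hopf algebroid over `L` with antipode `S`. -/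
structure IsCommHopfAlgebroid {η : A ⊗[L] Aᵐᵒᵖ →ₐ[L] V} (B : LeftBialgebroid η)
    (S : V →ₐ[L] V) : Prop where
  base_comm : ∀ a b : A, a * b = b * a
  total_comm : ∀ x y : V, x * y = y * x
  antipode_src : ∀ a : A, S (src η a) = tgt η a
  antipode_tgt : ∀ a : A, S (tgt η a) = src η a
  mul_antipode : ∀ (v : V) {n : ℕ} (x y : Fin n → V), B.coring.comul.toLin v = sumTmul η x y →
    ∑ i, x i * S (y i) = src η (B.coring.counit.toLin v)
  antipode_mul : ∀ (v : V) {n : ℕ} (x y : Fin n → V), B.coring.comul.toLin v = sumTmul η x y →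
    ∑ i, S (x i) * y i = tgt η (B.coring.counit.toLin v)
  antipode_antipode : ∀ v : V, S (S v) = v

end Bialgebroid

/-! ### Fibre functors and the infinite comatrix coring -/

section Fibre

variable {K : Type w} {A : Type u} [CommRing K] [Ring A] [Algebra K A]
variable {C : Type u} [Category.{v} C]

/-- The relations `φ ⊗ t p = φ t ⊗ p`, for `t` an endomorphism of `P`, in `ω(P)* ⊗_K ω(P)`. -/
def finComatrixRel (ω : C ⥤ BimodCat.{w, u} K A) (P : C) :
    Submodule K (dual (ω.obj P) ⊗[K] ω.obj P) :=
  Submodule.span K {z | ∃ (t : P ⟶ P) (φ : RDual (ω.obj P)) (p : ω.obj P),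
    z = (φ : dual (ω.obj P)) ⊗ₜ[K] (ω.map t).toLin p -
      (φ ∘ₗ rightLin (ω.map t) : dual (ω.obj P)) ⊗ₜ[K] p}

/-- The module `ω(P)* ⊗_T ω(P)`, where `T` is the endomorphism ring of `P`. -/
def FinComatrix (ω : C ⥤ BimodCat.{w, u} K A) (P : C) : Type u :=
  (dual (ω.obj P) ⊗[K] ω.obj P) ⧸ finComatrixRel ω P

instance (ω : C ⥤ BimodCat.{w, u} K A) (P : C) : AddCommGroup (FinComatrix ω P) :=
  inferInstanceAs (AddCommGroup ((dual (ω.obj P) ⊗[K] ω.obj P) ⧸ finComatrixRel ω P))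

instance (ω : C ⥤ BimodCat.{w, u} K A) (P : C) : Module K (FinComatrix ω P) :=
  inferInstanceAs (Module K ((dual (ω.obj P) ⊗[K] ω.obj P) ⧸ finComatrixRel ω P))

/-- The element `φ ⊗ p` of `ω(P)* ⊗_T ω(P)`, where `T` is the endomorphism ring of `P`. -/
def FinComatrix.mk (ω : C ⥤ BimodCat.{w, u} K A) (P : C) (φ : RDual (ω.obj P)) (p : ω.obj P) :
    FinComatrix ω P :=
  (finComatrixRel ω P).mkQ ((φ : dual (ω.obj P)) ⊗ₜ[K] p)

open Classical in
/-- The relations `φ ⊗ t p = φ t ⊗ p`, for `t : P ⟶ Q`, `φ ∈ ω(Q)*` and `p ∈ ω(P)`, in the direct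
sum of the modules `FinComatrix ω P`. -/
def comatrixRel (ω : C ⥤ BimodCat.{w, u} K A) : Submodule K (⨁ P : C, FinComatrix ω P) :=
  Submodule.span K {z | ∃ (P Q : C) (t : P ⟶ Q) (φ : RDual (ω.obj Q)) (p : ω.obj P),
    z = DirectSum.lof K C (FinComatrix ω) Q (FinComatrix.mk ω Q φ ((ω.map t).toLin p)) -
      DirectSum.lof K C (FinComatrix ω) P (FinComatrix.mk ω P (φ ∘ₗ rightLin (ω.map t)) p)}

/-- The underlying `K`-module of the infinite comatrix coring of `ω`. -/
abbrev Comatrix (ω : C ⥤ BimodCat.{w, u} K A) : Type u :=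
  (⨁ P : C, FinComatrix ω P) ⧸ comatrixRel ω

open Classical in
/-- The class of `φ ⊗ p` in the infinite comatrix coring. -/
noncomputable def Comatrix.mk (ω : C ⥤ BimodCat.{w, u} K A) (P : C) (φ : RDual (ω.obj P)) (p : ω.obj P) :
    Comatrix ω :=
  (comatrixRel ω).mkQ (DirectSum.lof K C (FinComatrix ω) P (FinComatrix.mk ω P φ p))

/-- `b` and `φ` form a finite dual basis of the right module `M`. -/
def IsDualBasis (M : BimodCat.{w, u} K A) {n : ℕ} (b : Fin n → M) (φ : Fin n → RDual M) : Prop :=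
  ∀ x : M, ∑ i, op (φ i x) • b i = x

variable [MonoidalCategory C]

/-- `C` is a Penrose category: on every hom-set the left and right actions of the
endomorphisms of the unit object coincide. -/
def IsPenrose (C : Type u) [Category.{v} C] [MonoidalCategory C] : Prop :=
  ∀ (P Q : C) (f : P ⟶ Q) (t : 𝟙_ C ⟶ 𝟙_ C),
    (λ_ P).inv ≫ (t ⊗ₘ f) ≫ (λ_ Q).hom = (ρ_ P).inv ≫ (f ⊗ₘ t) ≫ (ρ_ Q).hom

/-- The ring of endomorphisms of the unit object of `C`. The fibre functor `ω` is recorded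
because it makes `A` an algebra over this ring. -/
def UnitEnd (_ω : C ⥤ BimodCat.{w, u} K A) : Type v := End (𝟙_ C)

theorem unit_end_comm (f g : 𝟙_ C ⟶ 𝟙_ C) : f ≫ g = g ≫ f := by
  have hl : ∀ k : 𝟙_ C ⟶ 𝟙_ C, k = (λ_ (𝟙_ C)).inv ≫ 𝟙_ C ◁ k ≫ (λ_ (𝟙_ C)).hom := by simp
  have hr : ∀ k : 𝟙_ C ⟶ 𝟙_ C, k = (λ_ (𝟙_ C)).inv ≫ k ▷ 𝟙_ C ≫ (λ_ (𝟙_ C)).hom := by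
    simp [unitors_equal, unitors_inv_equal]
  calc f ≫ g = (λ_ (𝟙_ C)).inv ≫ (f ▷ 𝟙_ C ≫ 𝟙_ C ◁ g) ≫ (λ_ (𝟙_ C)).hom := by
        conv_lhs => rw [hr f, hl g]
        simp only [Category.assoc, Iso.hom_inv_id_assoc]
    _ = (λ_ (𝟙_ C)).inv ≫ (𝟙_ C ◁ g ≫ f ▷ 𝟙_ C) ≫ (λ_ (𝟙_ C)).hom := by
        rw [whisker_exchange]
    _ = g ≫ f := by
        conv_rhs => rw [hl g, hr f]
        simp only [Category.assoc, Iso.hom_inv_id_assoc]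

instance [Preadditive C] (ω : C ⥤ BimodCat.{w, u} K A) : CommRing (UnitEnd ω) :=
  { (inferInstance : Ring (End (𝟙_ C))) with
    mul_comm := fun f g => unit_end_comm (C := C) g f }

/-- The bimodule endomorphism of `A` induced by an endomorphism of the unit object. -/
def unitEndMap (ω : C ⥤ BimodCat.{w, u} K A) [ω.Monoidal] (t : 𝟙_ C ⟶ 𝟙_ C) :
    𝟙_ (BimodCat.{w, u} K A) ⟶ 𝟙_ (BimodCat.{w, u} K A) :=
  Functor.LaxMonoidal.ε ω ≫ ω.map t ≫ Functor.OplaxMonoidal.η ω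

theorem unitEndMap_comp (ω : C ⥤ BimodCat.{w, u} K A) [ω.Monoidal] (s t : 𝟙_ C ⟶ 𝟙_ C) :
    unitEndMap ω (s ≫ t) = unitEndMap ω s ≫ unitEndMap ω t := by
  simp [unitEndMap]

theorem unitEndMap_apply (ω : C ⥤ BimodCat.{w, u} K A) [ω.Monoidal] (t : 𝟙_ C ⟶ 𝟙_ C) (a : A) :
    (unitEndMap ω t).toLin a = a * ((unitEndMap ω t).toLin (1 : A) : A) := by
  have := toLin_left (unitEndMap ω t) a (1 : A)
  refine Eq.trans ?_ this
  exact congrArg _ (mul_one a).symm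

theorem unitEndMap_apply' (ω : C ⥤ BimodCat.{w, u} K A) [ω.Monoidal] (t : 𝟙_ C ⟶ 𝟙_ C) (a : A) :
    (unitEndMap ω t).toLin a = ((unitEndMap ω t).toLin (1 : A) : A) * a := by
  have := toLin_right (unitEndMap ω t) a (1 : A)
  refine Eq.trans ?_ this
  exact congrArg _ (one_mul a).symm

/-- The ring map from the endomorphisms of the unit object to `A ≅ ω(𝟙)`, `t ↦ ω(t)(1)`. -/
def unitEndHom [Preadditive C] (ω : C ⥤ BimodCat.{w, u} K A) [ω.Additive] [ω.Monoidal] : UnitEnd ω →+* A where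
  toFun t := (unitEndMap ω t).toLin (1 : A)
  map_one' := by
    have : unitEndMap ω (𝟙 (𝟙_ C)) = 𝟙 _ := by simp [unitEndMap]
    change (unitEndMap ω (𝟙 (𝟙_ C))).toLin (1 : A) = _
    rw [this]
    rfl
  map_mul' s t := by
    refine (congrArg (fun f : 𝟙_ (BimodCat.{w, u} K A) ⟶ 𝟙_ (BimodCat.{w, u} K A) =>
      f.toLin (1 : A)) (unitEndMap_comp ω t s)).trans ?_
    exact unitEndMap_apply' ω s _
  map_zero' := by
    have : unitEndMap ω (0 : 𝟙_ C ⟶ 𝟙_ C) = 0 := by simp [unitEndMap]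
    change (unitEndMap ω (0 : 𝟙_ C ⟶ 𝟙_ C)).toLin (1 : A) = _
    rw [this]
    rfl
  map_add' s t := by
    have : ∀ s t : 𝟙_ C ⟶ 𝟙_ C, unitEndMap ω (s + t) = unitEndMap ω s + unitEndMap ω t := by
      intro s t
      simp [unitEndMap, Functor.map_add]
    exact congrArg (fun f : 𝟙_ (BimodCat.{w, u} K A) ⟶ 𝟙_ (BimodCat.{w, u} K A) =>
      f.toLin (1 : A)) (this s t)

instance [Preadditive C] (ω : C ⥤ BimodCat.{w, u} K A) [ω.Additive] [ω.Monoidal] :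
    Algebra (UnitEnd ω) A :=
  (unitEndHom ω).toAlgebra' fun t a =>
    (unitEndMap_apply' ω t a).symm.trans (unitEndMap_apply ω t a)

/-- The element of `ω(P ⊗ Q)` corresponding to `x ⊗ y` in `ω(P) ⊗_A ω(Q)`. -/
def fibreTmul (ω : C ⥤ BimodCat.{w, u} K A) [ω.Monoidal] {P Q : C} (x : ω.obj P) (y : ω.obj Q) :
    ω.obj (P ⊗ Q) :=
  (Functor.LaxMonoidal.μ ω P Q).toLin (Tensor.tmul x y)

/-- The element of `ω(P ⊗ Q)*` corresponding to `φ ⋆ ψ` in `(ω(P) ⊗_A ω(Q))*`. -/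
def fibreStar (ω : C ⥤ BimodCat.{w, u} K A) [ω.Monoidal] {P Q : C} (φ : RDual (ω.obj P))
    (ψ : RDual (ω.obj Q)) : RDual (ω.obj (P ⊗ Q)) :=
  star φ ψ ∘ₗ rightLin (Functor.OplaxMonoidal.δ ω P Q)

/-- The pairing `ω(Pᘁ) × ω(P) → ω(Pᘁ ⊗ P) → ω(𝟙) ≅ A` induced by the evaluation of `P`. -/
def evalPairing (ω : C ⥤ BimodCat.{w, u} K A) [ω.Monoidal] (P : C) [HasRightDual P]
    (y : ω.obj Pᘁ) (x : ω.obj P) : A :=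
  (ω.map (ε_ P Pᘁ) ≫ Functor.OplaxMonoidal.η ω).toLin (fibreTmul ω y x)

/-- Let `A` be commutative. `ω` is a symmetric monoidal functor to `A`-modules: its values are
`A`-modules, viewed as bimodules whose two actions coincide, and it takes the symmetry of `C` to
the flip. -/
structure IsSymmetricFibre [BraidedCategory C] (ω : C ⥤ BimodCat.{w, u} K A) [ω.Monoidal] :
    Prop where
  central : ∀ (P : C) (a : A) (x : ω.obj P), op a • x = a • x
  braiding : ∀ (P Q : C) (x : ω.obj P) (y : ω.obj Q),
    (ω.map (β_ P Q).hom).toLin (fibreTmul ω x y) = fibreTmul ω y x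

end Fibre

/-!
The proof works with generators and relations throughout. Write `[φ ⊗ p]` for the class of
`φ ⊗ p ∈ ω(P)* ⊗ ω(P)`. Since the relations contain `φ ⊗ k p = k φ ⊗ p` (take the morphism `k • 𝟙`),
additive maps out of the comatrix coring are the families of biadditive maps on `ω(P)* × ω(P)` that
respect the relations (`ComatrixRing.liftAdd`). All structure maps are defined in this way, and all
identities are checked on classes `[φ ⊗ p]`.

* *Ring structure.* Associativity and unitality hold because the associator and the unitors of `C`
  are themselves morphisms occurring in the relations. The Penrose condition says that both actions
  of an endomorphism `t` of the unit object on `ω(P)` coincide, which makes `t` central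
  (`ComatrixRing.base_unitEnd_commute`).
* *Coring structure.* Well-definedness of `Δ`, its independence of the dual basis, and the Takeuchi
  condition are all instances of the identity `∑ g(eᵢ) ⊗ eᵢ* = ∑ fⱼ ⊗ (fⱼ* ∘ g)` for right linear maps
  `g` (`IsFiniteDualBasis.sum_balanced`). Multiplicativity of `Δ` holds because products of dual
  bases form a dual basis of `ω(P ⊗ Q)` (`IsFiniteDualBasis.fibreTmul`).
* *Left bialgebroid.* For any `×_A`-bialgebra `V`, the assignment `x ⊗ y ↦ x m ⊗ y n` is a
  well-defined map `V ⊗_A V → M ⊗_A N` (`ModuleOver.tensorEval`). Evaluating it at `Δ v` gives the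
  action of `v` on `m ⊗ n`, which is balanced by the Takeuchi condition; coassociativity and
  counitality of `Δ` then give the linearity of the constraints
  (`IsTimesBialgebra.leftBialgebroid`).
* *Antipode.* Let `D` be any right dual of `P`. The triangle identities say that the coevaluation is
  `∑ eᵢ ⊗ yᵢ` for a dual basis `eᵢ, ⟨yᵢ, -⟩` of `ω(P)`, so the pairing of `ω(D)` and `ω(P)` is perfect.
  By the relation for the mate of `𝟙 P`, the class `[⟨-, p⟩ ⊗ d]` with `⟨d, -⟩ = φ` does not depend on
  the choice of `D`; this is `S [φ ⊗ p]` (`ComatrixRing.antipodeHom_mk`). Choosing `D` to be the unit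
  object, a tensor product of duals, or `P` itself as a dual of its dual gives the values of `S` on the
  base, its multiplicativity, and `S² = id`. The two antipode identities are the relations for the
  coevaluation and the evaluation composed with the braiding.
-/

/-! ### Additive maps out of quotients and balanced tensor products -/

/-- An additive map killing a submodule factors through the quotient. -/
def Submodule.liftQAdd {R M X : Type*} [Ring R] [AddCommGroup M] [Module R M] [AddCommGroup X]
    (S : Submodule R M) (f : M →+ X) (h : ∀ x ∈ S, f x = 0) : M ⧸ S →+ X :=
  QuotientAddGroup.lift S.toAddSubgroup f h

/-- An additive map that kills every scalar multiple of every generator kills the span. -/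
theorem Submodule.addHom_eq_zero_of_span {R M X : Type*} [Ring R] [AddCommGroup M] [Module R M]
    [AddCommGroup X] {s : Set M} (f : M →+ X) (h : ∀ (r : R), ∀ x ∈ s, f (r • x) = 0)
    {x : M} (hx : x ∈ Submodule.span R s) : f x = 0 := by
  have key : ∀ r : R, f (r • x) = 0 := by
    induction hx using Submodule.span_induction with
    | mem x hx => exact fun r => h r x hx
    | zero => exact fun r => by rw [smul_zero, map_zero]
    | add x y _ _ hx hy => exact fun r => by rw [smul_add, map_add, hx, hy, add_zero]
    | smul a x _ hx => exact fun r => by rw [smul_smul, hx]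
  simpa using key 1

/-- A biadditive function as an iterated additive map. -/
def AddMonoidHom.ofBiadditive {M N X : Type*} [AddCommGroup M] [AddCommGroup N] [AddCommGroup X]
    (f : M → N → X) (hl : ∀ m m' n, f (m + m') n = f m n + f m' n)
    (hr : ∀ m n n', f m (n + n') = f m n + f m n') : M →+ N →+ X :=
  AddMonoidHom.mk' (fun m => AddMonoidHom.mk' (f m) (hr m))
    (fun m m' => AddMonoidHom.ext fun n => hl m m' n)

namespace BimodCat

section Additive

variable {K : Type w} {A : Type u} [CommRing K] [Ring A] [Algebra K A]

/-- A biadditive map that is balanced over `A` factors through the tensor product over `A`.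
It is automatically balanced over `K`, since `K` acts through `A` on both sides. -/
def Tensor.liftAdd {M N : BimodCat.{w, u} K A} {X : Type*} [AddCommGroup X] (f : M → N → X)
    (hl : ∀ m m' n, f (m + m') n = f m n + f m' n)
    (hr : ∀ m n n', f m (n + n') = f m n + f m n')
    (h : ∀ (m : M) (a : A) (n : N), f (op a • m) n = f m (a • n)) : Tensor M N →+ X :=
  have hK (k : K) (m : M) (n : N) : f (k • m) n = f m (k • n) := by
    have h1 : op (k • (1 : A)) • m = k • m := by
      rw [op_smul, op_one, smul_assoc, one_smul]
    have h2 : (k • (1 : A)) • n = k • n := by rw [smul_assoc, one_smul]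
    rw [← h1, h, h2]
  (balanced M N).liftQAdd
    (TensorProduct.liftAddHom (AddMonoidHom.ofBiadditive f hl hr) hK) (fun x hx => by
      refine Submodule.addHom_eq_zero_of_span _ ?_ hx
      rintro k _ ⟨m, a, n, rfl⟩
      rw [smul_sub, map_sub, sub_eq_zero, TensorProduct.smul_tmul', TensorProduct.smul_tmul',
        smul_comm k (op a) m]
      exact h (k • m) a n)

theorem Tensor.addHom_ext {M N : BimodCat.{w, u} K A} {X : Type*} [AddCommGroup X]
    {f g : Tensor M N →+ X} (h : ∀ m n, f (Tensor.tmul m n) = g (Tensor.tmul m n)) : f = g := by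
  ext x
  induction x using Tensor.induction with
  | zero => simp
  | tmul m n => exact h m n
  | add x y hx hy => rw [map_add, map_add, hx, hy]

theorem Tensor.zero_tmul {M N : BimodCat.{w, u} K A} (n : N) :
    Tensor.tmul (0 : M) n = 0 := by simp [Tensor.tmul]

theorem Tensor.sum_tmul {M N : BimodCat.{w, u} K A} {ι : Type*} (s : Finset ι) (m : ι → M)
    (n : N) : Tensor.tmul (∑ i ∈ s, m i) n = ∑ i ∈ s, Tensor.tmul (m i) n :=
  map_sum ((Tensor.mk M N).flip n) m s

theorem Tensor.tmul_sum {M N : BimodCat.{w, u} K A} {ι : Type*} (s : Finset ι) (m : M)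
    (n : ι → N) : Tensor.tmul m (∑ i ∈ s, n i) = ∑ i ∈ s, Tensor.tmul m (n i) :=
  map_sum (Tensor.mk M N m) n s

/-- An additive map that is linear for both actions of `A` is a map of bimodules. -/
def homOfAdd {M N : BimodCat.{w, u} K A} (f : M →+ N) (hl : ∀ (a : A) (x : M), f (a • x) = a • f x)
    (hr : ∀ (a : A) (x : M), f (op a • x) = op a • f x) : M ⟶ N where
  toLin :=
    { f with
      map_smul' := fun k x => by
        have h1 : (k • (1 : A)) • x = k • x := by rw [smul_assoc, one_smul]
        have h2 : (k • (1 : A)) • f x = k • f x := by rw [smul_assoc, one_smul]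
        change f (k • x) = k • f x
        rw [← h1, hl, h2] }
  map_left := hl
  map_right := hr

end Additive

end BimodCat

/-! ### Left bialgebroids from `×_A`-bialgebra axioms -/

section Takeuchi

variable {L : Type v} {A V : Type u} [CommRing L] [Ring A] [Algebra L A] [Ring V] [Algebra L V]
variable {η : A ⊗[L] Aᵐᵒᵖ →ₐ[L] V}

namespace ModuleOver

theorem act_src {M : BimodCat.{v, u} L A} (ρ : ModuleOver η M) (a : A) (x : M) :
    ρ.act (src η a) x = a • x := by
  have := ρ.act_base a 1 x
  rwa [op_one, one_smul] at this

theorem act_tgt {M : BimodCat.{v, u} L A} (ρ : ModuleOver η M) (a : A) (x : M) :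
    ρ.act (tgt η a) x = op a • x := by
  have := ρ.act_base 1 a x
  rwa [one_smul] at this

theorem act_mul {M : BimodCat.{v, u} L A} (ρ : ModuleOver η M) (v v' : V) (x : M) :
    ρ.act (v * v') x = ρ.act v (ρ.act v' x) := by
  rw [map_mul]; rfl

theorem act_add {M : BimodCat.{v, u} L A} (ρ : ModuleOver η M) (v v' : V) (x : M) :
    ρ.act (v + v') x = ρ.act v x + ρ.act v' x := by
  rw [map_add]; rfl

theorem act_src_mul {M : BimodCat.{v, u} L A} (ρ : ModuleOver η M) (a : A)
    (v : V) (x : M) : ρ.act (src η a * v) x = a • ρ.act v x :=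
  (ρ.act_mul (src η a) v x).trans (ρ.act_src a _)

theorem act_tgt_mul {M : BimodCat.{v, u} L A} (ρ : ModuleOver η M) (a : A)
    (v : V) (x : M) : ρ.act (tgt η a * v) x = op a • ρ.act v x :=
  (ρ.act_mul (tgt η a) v x).trans (ρ.act_tgt a _)

/-- The ring `V` as a left module over itself. -/
def regular (η : A ⊗[L] Aᵐᵒᵖ →ₐ[L] V) : ModuleOver η (ringBimod η) where
  act := Module.toAddMonoidEnd V V
  act_base a b x := by
    change η (a ⊗ₜ[L] op b) * x = η (1 ⊗ₜ[L] op b) * (η (a ⊗ₜ[L] 1) * x)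
    rw [← mul_assoc, ← map_mul, Algebra.TensorProduct.tmul_mul_tmul, one_mul, mul_one]

theorem regular_act (v v' : V) : (regular η).act v v' = v * v' := rfl

/-- For elements `m` and `n` of `V`-modules, the map `V ⊗_A V → M ⊗_A N`,
`x ⊗ y ↦ x m ⊗ y n`. -/
def tensorEval {M N : BimodCat.{v, u} L A} (ρ : ModuleOver η M) (σ : ModuleOver η N)
    (m : M) (n : N) : Tensor (ringBimod η) (ringBimod η) →+ Tensor M N :=
  Tensor.liftAdd (M := ringBimod η) (N := ringBimod η)
    (fun x y => Tensor.tmul (ρ.act x m) (σ.act y n))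
    (fun x x' y => by rw [act_add, Tensor.add_tmul])
    (fun x y y' => by rw [act_add, Tensor.tmul_add])
    (fun x a y => (congrArg (Tensor.tmul · (σ.act y n)) (ρ.act_tgt_mul a x m)).trans
      ((Tensor.smul_tmul _ a _).trans (congrArg (Tensor.tmul _) (σ.act_src_mul a y n).symm)))

section

variable {M N : BimodCat.{v, u} L A} (ρ : ModuleOver η M) (σ : ModuleOver η N)

theorem tensorEval_tmul (m : M) (n : N) (x y : V) :
    tensorEval ρ σ m n (Tensor.tmul (M := ringBimod η) (N := ringBimod η) x y) =
      Tensor.tmul (ρ.act x m) (σ.act y n) := rfl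

theorem tensorEval_sumTmul (m : M) (n : N) {k : ℕ} (x y : Fin k → V) :
    tensorEval ρ σ m n (sumTmul η x y) = ∑ i, Tensor.tmul (ρ.act (x i) m) (σ.act (y i) n) := by
  rw [sumTmul, map_sum]; rfl

theorem tensorEval_add_left (m m' : M) (n : N) (t : Tensor (ringBimod η) (ringBimod η)) :
    tensorEval ρ σ (m + m') n t = tensorEval ρ σ m n t + tensorEval ρ σ m' n t := by
  refine DFunLike.congr_fun (Tensor.addHom_ext (f := tensorEval ρ σ (m + m') n)
    (g := tensorEval ρ σ m n + tensorEval ρ σ m' n) fun x y => ?_) t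
  rw [AddMonoidHom.add_apply, tensorEval_tmul, tensorEval_tmul, tensorEval_tmul, map_add,
    Tensor.add_tmul]

theorem tensorEval_add_right (m : M) (n n' : N) (t : Tensor (ringBimod η) (ringBimod η)) :
    tensorEval ρ σ m (n + n') t = tensorEval ρ σ m n t + tensorEval ρ σ m n' t := by
  refine DFunLike.congr_fun (Tensor.addHom_ext (f := tensorEval ρ σ m (n + n'))
    (g := tensorEval ρ σ m n + tensorEval ρ σ m n') fun x y => ?_) t
  rw [AddMonoidHom.add_apply, tensorEval_tmul, tensorEval_tmul, tensorEval_tmul, map_add,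
    Tensor.tmul_add]

theorem tensorEval_act (m : M) (n : N) (x y : V) (t : Tensor (ringBimod η) (ringBimod η)) :
    tensorEval ρ σ m n (tensorEval (regular η) (regular η) x y t) =
      tensorEval ρ σ (ρ.act x m) (σ.act y n) t := by
  refine DFunLike.congr_fun (Tensor.addHom_ext
    (f := (tensorEval ρ σ m n).comp (tensorEval (regular η) (regular η) x y))
    (g := tensorEval ρ σ (ρ.act x m) (σ.act y n)) fun x' y' => ?_) t
  rw [AddMonoidHom.comp_apply, tensorEval_tmul, regular_act, regular_act, tensorEval_tmul,
    tensorEval_tmul, act_mul, act_mul]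

theorem tensorEval_left_smul (m : M) (n : N) (a : A) (t : Tensor (ringBimod η) (ringBimod η)) :
    tensorEval ρ σ m n (a • t) = a • tensorEval ρ σ m n t := by
  refine DFunLike.congr_fun (Tensor.addHom_ext
    (f := (tensorEval ρ σ m n).comp (DistribSMul.toAddMonoidHom _ a))
    (g := (DistribSMul.toAddMonoidHom _ a).comp (tensorEval ρ σ m n)) fun x' y' => ?_) t
  exact congrArg (Tensor.tmul · (σ.act y' n)) (ρ.act_src_mul a x' m)

theorem tensorEval_right_smul (m : M) (n : N) (a : A)
    (t : Tensor (ringBimod η) (ringBimod η)) :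
    tensorEval ρ σ m n (op a • t) = op a • tensorEval ρ σ m n t := by
  refine DFunLike.congr_fun (Tensor.addHom_ext
    (f := (tensorEval ρ σ m n).comp (DistribSMul.toAddMonoidHom _ (op a)))
    (g := (DistribSMul.toAddMonoidHom _ (op a)).comp (tensorEval ρ σ m n)) fun x' y' => ?_) t
  exact congrArg (Tensor.tmul (ρ.act x' m)) (σ.act_tgt_mul a y' n)

end

end ModuleOver

open ModuleOver

/-- The comultiplication takes values in the Sweedler-Takeuchi product:
`v₁ tgt(a) ⊗ v₂ = v₁ ⊗ v₂ src(a)`. -/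
def IsTakeuchi (cor : ComonObj (ringBimod η)) : Prop :=
  ∀ (v : V) (a : A),
    tensorEval (regular η) (regular η) (tgt η a) (1 : V) (cor.comul.toLin v) =
      tensorEval (regular η) (regular η) (1 : V) (src η a) (cor.comul.toLin v)

namespace IsTakeuchi

variable {cor : ComonObj (ringBimod η)} {M N : BimodCat.{v, u} L A}

theorem tensorEval_comul_balanced (h : IsTakeuchi cor) (ρ : ModuleOver η M) (σ : ModuleOver η N)
    (v : V) (m : M) (a : A) (n : N) :
    tensorEval ρ σ (op a • m) n (cor.comul.toLin v) =
      tensorEval ρ σ m (a • n) (cor.comul.toLin v) := by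
  have := congrArg (tensorEval ρ σ m n) (h v a)
  rwa [tensorEval_act, tensorEval_act, act_tgt, act_src, map_one, map_one] at this

/-- The action of `v` on `M ⊗_A N`, `m ⊗ n ↦ v₁ m ⊗ v₂ n`. It is well defined because `Δ` takes
values in the Sweedler-Takeuchi product. -/
def tensorAct (h : IsTakeuchi cor) (ρ : ModuleOver η M) (σ : ModuleOver η N) (v : V) :
    Tensor M N →+ Tensor M N :=
  Tensor.liftAdd (fun m n => tensorEval ρ σ m n (cor.comul.toLin v))
    (fun _ _ _ => tensorEval_add_left ρ σ _ _ _ _)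
    (fun _ _ _ => tensorEval_add_right ρ σ _ _ _ _)
    (fun m a n => h.tensorEval_comul_balanced ρ σ v m a n)

theorem tensorAct_tmul (h : IsTakeuchi cor) (ρ : ModuleOver η M) (σ : ModuleOver η N) (v : V)
    (m : M) (n : N) :
    h.tensorAct ρ σ v (Tensor.tmul m n) = tensorEval ρ σ m n (cor.comul.toLin v) := rfl

theorem tensorAct_add (h : IsTakeuchi cor) (ρ : ModuleOver η M) (σ : ModuleOver η N) (v v' : V) :
    h.tensorAct ρ σ (v + v') = h.tensorAct ρ σ v + h.tensorAct ρ σ v' := by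
  refine Tensor.addHom_ext fun m n => ?_
  rw [AddMonoidHom.add_apply, tensorAct_tmul, tensorAct_tmul, tensorAct_tmul, ← map_add]
  exact congrArg _ (map_add cor.comul.toLin _ _)

/-- The maps `V ⊗_A V → M ⊗_A N` are `V`-linear. -/
theorem tensorEval_tensorAct (h : IsTakeuchi cor) (ρ : ModuleOver η M) (σ : ModuleOver η N)
    (m : M) (n : N) (v : V) (t : Tensor (ringBimod η) (ringBimod η)) :
    tensorEval ρ σ m n (h.tensorAct (regular η) (regular η) v t) =
      h.tensorAct ρ σ v (tensorEval ρ σ m n t) := by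
  refine DFunLike.congr_fun (Tensor.addHom_ext
    (f := (tensorEval ρ σ m n).comp (h.tensorAct (regular η) (regular η) v))
    (g := (h.tensorAct ρ σ v).comp (tensorEval ρ σ m n)) fun x y => ?_) t
  exact tensorEval_act ρ σ m n x y _

end IsTakeuchi

/-- The axioms of a left `×_A`-bialgebra on an `A ⊗[L] Aᵐᵒᵖ`-ring with an `A`-coring structure. The
multiplicativity of `Δ` is expressed as `Δ (v w) = v · Δ w` for the action of `V` on `V ⊗_A V`. -/
structure IsTimesBialgebra (cor : ComonObj (ringBimod η)) : Prop where
  takeuchi : IsTakeuchi cor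
  comul_mul : ∀ v v' : V, cor.comul.toLin (v * v') =
    takeuchi.tensorAct (regular η) (regular η) v (cor.comul.toLin v')
  comul_one : cor.comul.toLin (1 : V) =
    Tensor.tmul (M := ringBimod η) (N := ringBimod η) (1 : V) (1 : V)
  counit_one : cor.counit.toLin (1 : V) = (1 : A)
  counit_mul_src : ∀ v v' : V,
    cor.counit.toLin (v * v') = cor.counit.toLin (v * src η (cor.counit.toLin v'))
  counit_mul_tgt : ∀ v v' : V,
    cor.counit.toLin (v * v') = cor.counit.toLin (v * tgt η (cor.counit.toLin v'))

end Takeuchi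

namespace IsTimesBialgebra

open ModuleOver

variable {L : Type v} {A V : Type u} [CommRing L] [Ring A] [Algebra L A] [Ring V] [Algebra L V]
variable {η : A ⊗[L] Aᵐᵒᵖ →ₐ[L] V} {cor : ComonObj (ringBimod η)}
variable {M N P : BimodCat.{v, u} L A}

theorem comul_base_mul (cor : ComonObj (ringBimod η)) (a b : A) (v : V) :
    cor.comul.toLin (η (a ⊗ₜ op b) * v) = op b • a • cor.comul.toLin v := by
  have h : η (a ⊗ₜ op b) * v = tgt η b * (src η a * v) := by
    rw [src, tgt, ← mul_assoc, ← map_mul, Algebra.TensorProduct.tmul_mul_tmul, one_mul, mul_one]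
  rw [h]
  exact (toLin_right cor.comul b (src η a * v : V)).trans
    (congrArg (op b • ·) (toLin_left cor.comul a v))

theorem counit_base_mul (cor : ComonObj (ringBimod η)) (a b : A) (v : V) :
    cor.counit.toLin (η (a ⊗ₜ op b) * v) = (a * (cor.counit.toLin v : A) * b : A) := by
  have h : η (a ⊗ₜ op b) * v = tgt η b * (src η a * v) := by
    rw [src, tgt, ← mul_assoc, ← map_mul, Algebra.TensorProduct.tmul_mul_tmul, one_mul, mul_one]
  rw [h]
  exact (toLin_right cor.counit b (src η a * v : V)).trans
    (congrArg (fun z : A => z * b) (toLin_left cor.counit a v))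

theorem counit_src (h : IsTimesBialgebra cor) (a : A) : cor.counit.toLin (src η a) = a := by
  have := counit_base_mul cor a 1 1
  rw [op_one, mul_one, h.counit_one] at this
  exact this.trans (by rw [mul_one, mul_one])

/-- The `V`-module structure on `M ⊗_A N`. -/
def tensorModule (h : IsTimesBialgebra cor) (ρ : ModuleOver η M) (σ : ModuleOver η N) :
    ModuleOver η (M ⊗ N) where
  act :=
    { toFun := h.takeuchi.tensorAct ρ σ
      map_one' := Tensor.addHom_ext fun m n => by
        rw [IsTakeuchi.tensorAct_tmul, h.comul_one, tensorEval_tmul, map_one, map_one]; rfl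
      map_mul' := fun v v' => Tensor.addHom_ext fun m n => by
        rw [IsTakeuchi.tensorAct_tmul, h.comul_mul, IsTakeuchi.tensorEval_tensorAct]; rfl
      map_zero' := Tensor.addHom_ext fun m n => by
        rw [IsTakeuchi.tensorAct_tmul]
        exact (congrArg _ (map_zero cor.comul.toLin)).trans (map_zero _)
      map_add' := h.takeuchi.tensorAct_add ρ σ }
  act_base a b t := by
    refine DFunLike.congr_fun (Tensor.addHom_ext
      (f := h.takeuchi.tensorAct ρ σ (η (a ⊗ₜ op b)))
      (g := (DistribSMul.toAddMonoidHom _ (op b)).comp (DistribSMul.toAddMonoidHom _ a))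
      fun m n => ?_) t
    have h1 := comul_base_mul cor a b 1
    rw [mul_one] at h1
    rw [IsTakeuchi.tensorAct_tmul, h1, tensorEval_right_smul, tensorEval_left_smul, h.comul_one,
      tensorEval_tmul, map_one, map_one]
    rfl

theorem tensorModule_act_tmul (h : IsTimesBialgebra cor) (ρ : ModuleOver η M)
    (σ : ModuleOver η N) (v : V) (m : M) (n : N) :
    (h.tensorModule ρ σ).act v (Tensor.tmul m n) = tensorEval ρ σ m n (cor.comul.toLin v) := rfl

/-- The `V`-module structure on `A`, `v a = ε (v src(a))`. -/
def unitModule (h : IsTimesBialgebra cor) : ModuleOver η (𝟙_ (BimodCat.{v, u} L A)) where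
  act :=
    { toFun := fun v => AddMonoidHom.mk' (fun a : A => (cor.counit.toLin (v * src η a) : A))
        (fun a a' => by
          rw [src, TensorProduct.add_tmul, map_add, mul_add]; exact map_add cor.counit.toLin _ _)
      map_one' := AddMonoidHom.ext fun a : A => by
        change cor.counit.toLin ((1 : V) * src η a) = a
        rw [one_mul, h.counit_src]
      map_mul' := fun v v' => AddMonoidHom.ext fun a : A => by
        change cor.counit.toLin (v * v' * src η a) =
          cor.counit.toLin (v * src η (cor.counit.toLin (v' * src η a)))
        rw [mul_assoc, h.counit_mul_src]
      map_zero' := AddMonoidHom.ext fun a : A => by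
        change cor.counit.toLin ((0 : V) * src η a) = (0 : A)
        rw [zero_mul]; exact map_zero cor.counit.toLin
      map_add' := fun v v' => AddMonoidHom.ext fun a : A => by
        change cor.counit.toLin ((v + v') * src η a) = (_ : A)
        rw [add_mul]; exact map_add cor.counit.toLin _ _ }
  act_base a b (x : A) := by
    change cor.counit.toLin (η (a ⊗ₜ op b) * src η x) = _
    rw [counit_base_mul, h.counit_src]
    rfl

/-- The action of `V` on tensor products is coassociative because `Δ` is. -/
theorem tensorModule_assoc (h : IsTimesBialgebra cor) (ρ : ModuleOver η M)
    (σ : ModuleOver η N) (τ : ModuleOver η P) :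
    (h.tensorModule (h.tensorModule ρ σ) τ).IsLinear (h.tensorModule ρ (h.tensorModule σ τ))
      (α_ M N P).hom := by
  intro v t
  -- Evaluating the coassociativity of `Δ` at the elements of the three modules.
  let ev : ∀ (m : M) (n : N) (p : P),
      Tensor (ringBimod η) (tensor (ringBimod η) (ringBimod η)) →+ Tensor M (tensor N P) :=
    fun m n p => Tensor.liftAdd (M := ringBimod η) (N := tensor (ringBimod η) (ringBimod η))
      (fun x s => Tensor.tmul (N := tensor N P) (ρ.act x m) (tensorEval σ τ n p s))
      (fun x x' s => by rw [act_add, Tensor.add_tmul])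
      (fun x s s' => by rw [map_add, Tensor.tmul_add])
      (fun x a s => by
        refine (congrArg (Tensor.tmul (N := tensor N P) · (tensorEval σ τ n p s))
          (ρ.act_tgt_mul a x m)).trans ?_
        rw [tensorEval_left_smul]
        exact Tensor.smul_tmul (N := tensor N P) _ a _)
  have h1 : ∀ (m : M) (n : N) (p : P) (s : Tensor (ringBimod η) (ringBimod η)),
      (h.tensorModule ρ (h.tensorModule σ τ)).act v
        (Tensor.tmul (N := tensor N P) m (Tensor.tmul n p)) =
      ev m n p ((ringBimod η ◁ cor.comul).toLin (cor.comul.toLin v)) := by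
    intro m n p _
    refine (h.tensorModule_act_tmul ρ (h.tensorModule σ τ) v m (Tensor.tmul n p)).trans ?_
    refine DFunLike.congr_fun (Tensor.addHom_ext
      (f := tensorEval ρ (h.tensorModule σ τ) m (Tensor.tmul n p))
      (g := (ev m n p).comp (ringBimod η ◁ cor.comul).toLin.toAddMonoidHom) fun x y => ?_) _
    rfl
  have h2 : ∀ (m : M) (n : N) (p : P),
      (α_ M N P).hom.toLin ((h.tensorModule (h.tensorModule ρ σ) τ).act v
        (Tensor.tmul (M := tensor M N) (Tensor.tmul m n) p)) =
      ev m n p ((α_ (ringBimod η) (ringBimod η) (ringBimod η)).hom.toLin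
        ((cor.comul ▷ ringBimod η).toLin (cor.comul.toLin v))) := by
    intro m n p
    refine (congrArg (α_ M N P).hom.toLin
      (h.tensorModule_act_tmul (h.tensorModule ρ σ) τ v (Tensor.tmul m n) p)).trans ?_
    refine DFunLike.congr_fun (Tensor.addHom_ext
      (f := (α_ M N P).hom.toLin.toAddMonoidHom.comp
        (tensorEval (h.tensorModule ρ σ) τ (Tensor.tmul m n) p))
      (g := (ev m n p).comp ((α_ (ringBimod η) (ringBimod η) (ringBimod η)).hom.toLin.toAddMonoidHom.comp
        (cor.comul ▷ ringBimod η).toLin.toAddMonoidHom)) fun x y => ?_) _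
    change (α_ M N P).hom.toLin (Tensor.tmul (M := tensor M N)
        (tensorEval ρ σ m n (cor.comul.toLin x)) (τ.act y p)) =
      ev m n p ((α_ (ringBimod η) (ringBimod η) (ringBimod η)).hom.toLin
        (Tensor.tmul (M := tensor (ringBimod η) (ringBimod η)) (cor.comul.toLin x) y))
    induction (cor.comul.toLin x) using Tensor.induction with
    | zero =>
      rw [map_zero, Tensor.zero_tmul, map_zero, Tensor.zero_tmul, map_zero, map_zero]
    | tmul x' y' => rfl
    | add s t hs ht =>
      rw [map_add, Tensor.add_tmul, map_add, hs, ht, Tensor.add_tmul, map_add, map_add]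
  have hc : (α_ (ringBimod η) (ringBimod η) (ringBimod η)).hom.toLin ((cor.comul ▷ ringBimod η).toLin (cor.comul.toLin v)) =
      (ringBimod η ◁ cor.comul).toLin (cor.comul.toLin v) :=
    (congrArg (fun f => f.toLin v) cor.comul_assoc).symm
  refine DFunLike.congr_fun (f := (α_ M N P).hom.toLin.toAddMonoidHom.comp
      ((h.tensorModule (h.tensorModule ρ σ) τ).act v))
    (g := ((h.tensorModule ρ (h.tensorModule σ τ)).act v).comp
      (α_ M N P).hom.toLin.toAddMonoidHom) (Tensor.addHom_ext fun s p => ?_) t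
  induction s using Tensor.induction with
  | zero => rw [Tensor.zero_tmul, map_zero, map_zero]
  | tmul m n => exact (h2 m n p).trans ((congrArg (ev m n p) hc).trans (h1 m n p 0).symm)
  | add s t hs ht => rw [Tensor.add_tmul, map_add, map_add, hs, ht]

theorem tensorModule_leftUnitor (h : IsTimesBialgebra cor) (ρ : ModuleOver η M) :
    (h.tensorModule h.unitModule ρ).IsLinear ρ (λ_ M).hom := by
  intro v t
  refine DFunLike.congr_fun (f := (λ_ M).hom.toLin.toAddMonoidHom.comp
      ((h.tensorModule h.unitModule ρ).act v))
    (g := (ρ.act v).comp (λ_ M).hom.toLin.toAddMonoidHom)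
    (Tensor.addHom_ext fun (a : A) m => ?_) t
  -- It suffices to treat the elements `1 ⊗ m`, for which this is counitality.
  have ha : Tensor.tmul (M := unit L A) a m = Tensor.tmul (M := unit L A) (1 : A) (a • m) := by
    rw [← Tensor.smul_tmul]
    exact congrArg (Tensor.tmul (M := unit L A) · m) (one_mul a).symm
  change (λ_ M).hom.toLin ((h.tensorModule h.unitModule ρ).act v
    (Tensor.tmul (M := unit L A) a m)) = ρ.act v (a • m)
  rw [ha]
  generalize a • m = m
  have hc : (λ_ (ringBimod η)).hom.toLin ((cor.counit ▷ ringBimod η).toLin (cor.comul.toLin v)) = v :=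
    (congrArg (fun f => (λ_ (ringBimod η)).hom.toLin (f.toLin v)) cor.counit_comul).trans
      (congrArg (fun f => f.toLin v) (λ_ (ringBimod η)).inv_hom_id)
  refine Eq.trans ?_ (congrArg (fun z => ρ.act z m) hc)
  refine DFunLike.congr_fun (f := (λ_ M).hom.toLin.toAddMonoidHom.comp
      (tensorEval h.unitModule ρ (1 : A) m))
    (g := ((AddMonoidHom.eval m).comp ρ.act.toAddMonoidHom).comp
      ((λ_ (ringBimod η)).hom.toLin.toAddMonoidHom.comp
        (cor.counit ▷ ringBimod η).toLin.toAddMonoidHom))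
    (Tensor.addHom_ext fun x y => ?_) (cor.comul.toLin v)
  change cor.counit.toLin (x * src η 1) • ρ.act y m = ρ.act (src η (cor.counit.toLin x) * y) m
  rw [act_src_mul, src, ← Algebra.TensorProduct.one_def, map_one]
  exact congrArg (fun z => cor.counit.toLin z • ρ.act y m) (mul_one (x : V))

theorem tensorModule_rightUnitor (h : IsTimesBialgebra cor) (ρ : ModuleOver η M) :
    (h.tensorModule ρ h.unitModule).IsLinear ρ (ρ_ M).hom := by
  intro v t
  refine DFunLike.congr_fun (f := (ρ_ M).hom.toLin.toAddMonoidHom.comp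
      ((h.tensorModule ρ h.unitModule).act v))
    (g := (ρ.act v).comp (ρ_ M).hom.toLin.toAddMonoidHom)
    (Tensor.addHom_ext fun m (a : A) => ?_) t
  -- It suffices to treat the elements `m ⊗ 1`, for which this is counitality.
  have ha : Tensor.tmul (N := unit L A) m a = Tensor.tmul (N := unit L A) (op a • m) (1 : A) := by
    rw [Tensor.smul_tmul]
    exact congrArg (Tensor.tmul (N := unit L A) m) (mul_one a).symm
  change (ρ_ M).hom.toLin ((h.tensorModule ρ h.unitModule).act v
    (Tensor.tmul (N := unit L A) m a)) = ρ.act v (op a • m)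
  rw [ha]
  generalize op a • m = m
  have hc : (ρ_ (ringBimod η)).hom.toLin ((ringBimod η ◁ cor.counit).toLin (cor.comul.toLin v)) = v :=
    (congrArg (fun f => (ρ_ (ringBimod η)).hom.toLin (f.toLin v)) cor.comul_counit).trans
      (congrArg (fun f => f.toLin v) (ρ_ (ringBimod η)).inv_hom_id)
  refine Eq.trans ?_ (congrArg (fun z => ρ.act z m) hc)
  refine DFunLike.congr_fun (f := (ρ_ M).hom.toLin.toAddMonoidHom.comp
      (tensorEval ρ h.unitModule m (1 : A)))
    (g := ((AddMonoidHom.eval m).comp ρ.act.toAddMonoidHom).comp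
      ((ρ_ (ringBimod η)).hom.toLin.toAddMonoidHom.comp
        (ringBimod η ◁ cor.counit).toLin.toAddMonoidHom))
    (Tensor.addHom_ext fun x y => ?_) (cor.comul.toLin v)
  change op (cor.counit.toLin (y * src η 1) : A) • ρ.act x m =
    ρ.act (tgt η (cor.counit.toLin y) * x) m
  rw [act_tgt_mul, src, ← Algebra.TensorProduct.one_def, map_one]
  exact congrArg (fun z => op (cor.counit.toLin z : A) • ρ.act x m) (mul_one (y : V))

/-- The monoidal structure on left `V`-modules. -/
def monoidalLift (h : IsTimesBialgebra cor) : MonoidalLift η where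
  tensor ρ σ := h.tensorModule ρ σ
  unit := h.unitModule
  tensorHom {M M' N N'} ρ ρ' σ σ' f g hf hg v t := by
    refine DFunLike.congr_fun (f := (f ⊗ₘ g).toLin.toAddMonoidHom.comp
        ((h.tensorModule ρ σ).act v))
      (g := ((h.tensorModule ρ' σ').act v).comp (f ⊗ₘ g).toLin.toAddMonoidHom)
      (Tensor.addHom_ext fun m n => ?_) t
    refine DFunLike.congr_fun (f := (f ⊗ₘ g).toLin.toAddMonoidHom.comp (tensorEval ρ σ m n))
      (g := tensorEval ρ' σ' (f.toLin m) (g.toLin n)) (Tensor.addHom_ext fun x y => ?_)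
      (cor.comul.toLin v)
    change Tensor.tmul (f.toLin (ρ.act x m)) (g.toLin (σ.act y n)) = _
    rw [hf, hg]
    rfl
  associator := h.tensorModule_assoc
  leftUnitor := h.tensorModule_leftUnitor
  rightUnitor := h.tensorModule_rightUnitor

/-- A left `×_A`-bialgebra is a left bialgebroid. -/
def leftBialgebroid (h : IsTimesBialgebra cor) : LeftBialgebroid η where
  lift := h.monoidalLift
  coring := cor
  tensor_act ρ σ v n x y hv m m' := by
    refine (h.tensorModule_act_tmul ρ σ v m m').trans ?_
    rw [hv, tensorEval_sumTmul]
  unit_act v a := rfl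
  takeuchi v n x y hv a := by
    have := h.takeuchi v a
    rw [hv, tensorEval_sumTmul, tensorEval_sumTmul] at this
    have hx : (fun i => x i * (1 : V)) = x := funext fun i => mul_one _
    have hy : (fun i => y i * (1 : V)) = y := funext fun i => mul_one _
    exact (congrArg (sumTmul η fun i => x i * tgt η a) hy.symm).trans
      (this.trans (congrArg (sumTmul η · fun i => y i * src η a) hx))
  comul_mul v v' n n' x y x' y' hv hv' := by
    rw [h.comul_mul, hv', sumTmul, map_sum]
    simp only [IsTakeuchi.tensorAct_tmul, hv, tensorEval_sumTmul]
    exact Finset.sum_comm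
  comul_one := h.comul_one
  counit_one := h.counit_one
  counit_mul_src := h.counit_mul_src
  counit_mul_tgt := h.counit_mul_tgt

end IsTimesBialgebra

/-! ### Elements of the values of a strong monoidal functor to bimodules -/

section FibreElements

open Functor.LaxMonoidal Functor.OplaxMonoidal

variable {K : Type w} {A : Type u} [CommRing K] [Ring A] [Algebra K A]
variable {C : Type u} [Category.{v} C]

theorem map_id_toLin (ω : C ⥤ BimodCat.{w, u} K A) {P : C} (x : ω.obj P) :
    (ω.map (𝟙 P)).toLin x = x := by
  rw [ω.map_id]; rfl

theorem map_comp_toLin (ω : C ⥤ BimodCat.{w, u} K A) {P Q R : C} (f : P ⟶ Q) (g : Q ⟶ R)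
    (x : ω.obj P) : (ω.map (f ≫ g)).toLin x = (ω.map g).toLin ((ω.map f).toLin x) := by
  rw [ω.map_comp]; rfl

theorem map_hom_inv_toLin (ω : C ⥤ BimodCat.{w, u} K A) {P Q : C} (f : P ≅ Q) (x : ω.obj Q) :
    (ω.map f.hom).toLin ((ω.map f.inv).toLin x) = x := by
  rw [← map_comp_toLin, f.inv_hom_id, map_id_toLin]

theorem map_inv_hom_toLin (ω : C ⥤ BimodCat.{w, u} K A) {P Q : C} (f : P ≅ Q) (x : ω.obj P) :
    (ω.map f.inv).toLin ((ω.map f.hom).toLin x) = x := by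
  rw [← map_comp_toLin, f.hom_inv_id, map_id_toLin]

@[simp] theorem rightLin_apply {M N : BimodCat.{w, u} K A} (f : M ⟶ N) (x : M) :
    rightLin f x = f.toLin x := rfl

variable [MonoidalCategory C] (ω : C ⥤ BimodCat.{w, u} K A) [ω.Monoidal]

section

variable {P Q R P' Q' : C}

theorem add_fibreTmul (x x' : ω.obj P) (y : ω.obj Q) :
    fibreTmul ω (x + x') y = fibreTmul ω x y + fibreTmul ω x' y := by
  rw [fibreTmul, Tensor.add_tmul]; exact map_add (μ ω P Q).toLin _ _

theorem fibreTmul_add (x : ω.obj P) (y y' : ω.obj Q) :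
    fibreTmul ω x (y + y') = fibreTmul ω x y + fibreTmul ω x y' := by
  rw [fibreTmul, Tensor.tmul_add]; exact map_add (μ ω P Q).toLin _ _

theorem left_smul_fibreTmul (a : A) (x : ω.obj P) (y : ω.obj Q) :
    a • fibreTmul ω x y = fibreTmul ω (a • x) y :=
  (toLin_left (μ ω P Q) a _).symm

theorem right_smul_fibreTmul (a : A) (x : ω.obj P) (y : ω.obj Q) :
    op a • fibreTmul ω x y = fibreTmul ω x (op a • y) :=
  (toLin_right (μ ω P Q) a _).symm

theorem fibreTmul_balanced (x : ω.obj P) (a : A) (y : ω.obj Q) :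
    fibreTmul ω (op a • x) y = fibreTmul ω x (a • y) := by
  rw [fibreTmul, Tensor.smul_tmul, fibreTmul]

theorem zero_fibreTmul (y : ω.obj Q) : fibreTmul ω (0 : ω.obj P) y = 0 := by
  rw [fibreTmul, Tensor.zero_tmul]; exact map_zero (μ ω P Q).toLin

theorem fibreTmul_induction {p : ω.obj (P ⊗ Q) → Prop} (z : ω.obj (P ⊗ Q)) (zero : p 0)
    (tmul : ∀ x y, p (fibreTmul ω x y)) (add : ∀ z z', p z → p z' → p (z + z')) : p z := by
  have hz : (μ ω P Q).toLin ((δ ω P Q).toLin z) = z :=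
    congrArg (fun f => f.toLin z) (Functor.Monoidal.δ_μ ω P Q)
  rw [← hz]
  generalize (δ ω P Q).toLin z = t
  induction t using Tensor.induction with
  | zero => rw [map_zero]; exact zero
  | tmul x y => exact tmul x y
  | add s t hs ht => rw [map_add]; exact add _ _ hs ht

theorem map_fibreTmul (f : P ⟶ P') (g : Q ⟶ Q') (x : ω.obj P) (y : ω.obj Q) :
    (ω.map (f ⊗ₘ g)).toLin (fibreTmul ω x y) =
      fibreTmul ω ((ω.map f).toLin x) ((ω.map g).toLin y) :=
  congrArg (fun h => h.toLin (Tensor.tmul x y)) (μ_natural ω f g).symm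

theorem map_whiskerRight_fibreTmul (f : P ⟶ P') (x : ω.obj P) (y : ω.obj Q) :
    (ω.map (f ▷ Q)).toLin (fibreTmul ω x y) = fibreTmul ω ((ω.map f).toLin x) y := by
  rw [← tensorHom_id, map_fibreTmul, map_id_toLin]

theorem map_whiskerLeft_fibreTmul (g : Q ⟶ Q') (x : ω.obj P) (y : ω.obj Q) :
    (ω.map (P ◁ g)).toLin (fibreTmul ω x y) = fibreTmul ω x ((ω.map g).toLin y) := by
  rw [← id_tensorHom, map_fibreTmul, map_id_toLin]

theorem map_associator_fibreTmul (x : ω.obj P) (y : ω.obj Q) (z : ω.obj R) :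
    (ω.map (α_ P Q R).hom).toLin (fibreTmul ω (fibreTmul ω x y) z) =
      fibreTmul ω x (fibreTmul ω y z) :=
  congrArg (fun h => h.toLin (Tensor.tmul (M := tensor (ω.obj P) (ω.obj Q)) (Tensor.tmul x y) z))
    (Functor.LaxMonoidal.associativity ω P Q R)

theorem map_associator_inv_fibreTmul (x : ω.obj P) (y : ω.obj Q) (z : ω.obj R) :
    (ω.map (α_ P Q R).inv).toLin (fibreTmul ω x (fibreTmul ω y z)) =
      fibreTmul ω (fibreTmul ω x y) z := by
  rw [← map_associator_fibreTmul, map_inv_hom_toLin]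

/-- The element of `ω(𝟙)` corresponding to `a ∈ A`. -/
def fibreUnit (a : A) : ω.obj (𝟙_ C) := (ε ω).toLin a

/-- The element of `A` corresponding to an element of `ω(𝟙)`. -/
def fibreCounit (x : ω.obj (𝟙_ C)) : A := (η ω).toLin x

theorem fibreCounit_unit (a : A) : fibreCounit ω (fibreUnit ω a) = a :=
  congrArg (fun h => h.toLin a) (Functor.Monoidal.ε_η ω)

theorem fibreUnit_counit (x : ω.obj (𝟙_ C)) : fibreUnit ω (fibreCounit ω x) = x :=
  congrArg (fun h => h.toLin x) (Functor.Monoidal.η_ε ω)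

theorem fibreUnit_add (a b : A) : fibreUnit ω (a + b) = fibreUnit ω a + fibreUnit ω b :=
  map_add (ε ω).toLin a b

theorem left_smul_fibreUnit (a b : A) : a • fibreUnit ω b = fibreUnit ω (a * b) :=
  (toLin_left (ε ω) a b).symm

theorem right_smul_fibreUnit (a b : A) : op a • fibreUnit ω b = fibreUnit ω (b * a) :=
  (toLin_right (ε ω) a b).symm

theorem map_leftUnitor_fibreTmul (a : A) (x : ω.obj P) :
    (ω.map (λ_ P).hom).toLin (fibreTmul ω (fibreUnit ω a) x) = a • x :=
  congrArg (fun h => h.toLin (Tensor.tmul (M := unit K A) a x)) (Functor.LaxMonoidal.left_unitality ω P).symm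

theorem map_rightUnitor_fibreTmul (a : A) (x : ω.obj P) :
    (ω.map (ρ_ P).hom).toLin (fibreTmul ω x (fibreUnit ω a)) = op a • x :=
  congrArg (fun h => h.toLin (Tensor.tmul (N := unit K A) x a)) (Functor.LaxMonoidal.right_unitality ω P).symm

theorem map_leftUnitor_inv_apply (x : ω.obj P) :
    (ω.map (λ_ P).inv).toLin x = fibreTmul ω (fibreUnit ω 1) x := by
  have := map_leftUnitor_fibreTmul ω 1 x
  rw [one_smul] at this
  rw [← map_inv_hom_toLin ω (λ_ P) (fibreTmul ω (fibreUnit ω 1) x), this]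

theorem map_rightUnitor_inv_apply (x : ω.obj P) :
    (ω.map (ρ_ P).inv).toLin x = fibreTmul ω x (fibreUnit ω 1) := by
  have := map_rightUnitor_fibreTmul ω 1 x
  rw [op_one, one_smul] at this
  rw [← map_inv_hom_toLin ω (ρ_ P) (fibreTmul ω x (fibreUnit ω 1)), this]

/-! ### Elements of the dual bimodules -/

theorem RDual.map_op_smul {M : BimodCat.{w, u} K A} (φ : RDual M) (a : A) (x : M) :
    φ (op a • x) = φ x * a := φ.map_smul (op a) x

@[simp] theorem fibreStar_apply (φ : RDual (ω.obj P)) (ψ : RDual (ω.obj Q)) (x : ω.obj P)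
    (y : ω.obj Q) : fibreStar ω φ ψ (fibreTmul ω x y) = ψ (φ x • y) := by
  have h : (δ ω P Q).toLin (fibreTmul ω x y) = Tensor.tmul x y :=
    congrArg (fun f => f.toLin (Tensor.tmul x y)) (Functor.Monoidal.μ_δ ω P Q)
  exact congrArg (star φ ψ) h

theorem RDual.fibre_ext {φ ψ : RDual (ω.obj (P ⊗ Q))}
    (h : ∀ x y, φ (fibreTmul ω x y) = ψ (fibreTmul ω x y)) : φ = ψ := by
  ext z
  induction z using fibreTmul_induction with
  | zero => rw [map_zero, map_zero]
  | tmul x y => exact h x y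
  | add z z' hz hz' => rw [map_add, map_add, hz, hz']

theorem RDual.fibre_ext₃ {φ ψ : RDual (ω.obj ((P ⊗ Q) ⊗ R))}
    (h : ∀ x y z, φ (fibreTmul ω (fibreTmul ω x y) z) = ψ (fibreTmul ω (fibreTmul ω x y) z)) :
    φ = ψ := by
  refine RDual.fibre_ext ω fun s z => ?_
  induction s using fibreTmul_induction with
  | zero => rw [zero_fibreTmul, map_zero, map_zero]
  | tmul x y => exact h x y z
  | add s s' hs hs' => rw [add_fibreTmul, map_add, map_add, hs, hs']

theorem RDual.unit_ext {φ ψ : RDual (ω.obj (𝟙_ C))}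
    (h : φ (fibreUnit ω 1) = ψ (fibreUnit ω 1)) : φ = ψ := by
  ext x
  have hx : x = op (fibreCounit ω x) • fibreUnit ω 1 := by
    rw [right_smul_fibreUnit, one_mul, fibreUnit_counit]
  rw [hx, RDual.map_op_smul, RDual.map_op_smul, h]

theorem fibreStar_add (φ : RDual (ω.obj P)) (ψ ψ' : RDual (ω.obj Q)) :
    fibreStar ω φ (ψ + ψ') = fibreStar ω φ ψ + fibreStar ω φ ψ' :=
  RDual.fibre_ext ω fun x y => by simp

theorem add_fibreStar (φ φ' : RDual (ω.obj P)) (ψ : RDual (ω.obj Q)) :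
    fibreStar ω (φ + φ') ψ = fibreStar ω φ ψ + fibreStar ω φ' ψ :=
  RDual.fibre_ext ω fun x y => by simp [add_smul]

theorem fibreStar_comp_map (φ : RDual (ω.obj P')) (ψ : RDual (ω.obj Q')) (f : P ⟶ P')
    (g : Q ⟶ Q') : fibreStar ω φ ψ ∘ₗ rightLin (ω.map (f ⊗ₘ g)) =
      fibreStar ω (φ ∘ₗ rightLin (ω.map f)) (ψ ∘ₗ rightLin (ω.map g)) :=
  RDual.fibre_ext ω fun x y => by
    simp only [LinearMap.comp_apply, rightLin_apply, map_fibreTmul, fibreStar_apply, toLin_left]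

/-- The functional `r ↦ a r` on `ω(𝟙) ≅ A`. -/
def fibreLeftMul (a : A) : RDual (ω.obj (𝟙_ C)) := leftMul K a ∘ₗ rightLin (η ω)

@[simp] theorem fibreLeftMul_apply (a : A) (x : ω.obj (𝟙_ C)) :
    fibreLeftMul ω a x = a * fibreCounit ω x := rfl

end

end FibreElements

/-! ### The infinite comatrix coring as a ring -/

section Lift

variable {K : Type w} {A : Type u} [CommRing K] [Ring A] [Algebra K A]
variable {C : Type u} [Category.{v} C]

/-- The infinite comatrix coring of `ω`, as a type of its own that carries the ring structure. -/
def ComatrixRing (ω : C ⥤ BimodCat.{w, u} K A) : Type u := Comatrix ω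

namespace ComatrixRing

instance (ω : C ⥤ BimodCat.{w, u} K A) : AddCommGroup (ComatrixRing ω) :=
  inferInstanceAs (AddCommGroup (Comatrix ω))

section Mk

variable (ω : C ⥤ BimodCat.{w, u} K A)

/-- The class of `φ ⊗ p`. -/
noncomputable def mk (P : C) (φ : RDual (ω.obj P)) (p : ω.obj P) : ComatrixRing ω :=
  Comatrix.mk ω P φ p

open Classical in
/-- The class of `φ ⊗ p`, as an additive function of `φ ⊗ p ∈ ω(P)* ⊗_K ω(P)`. -/
noncomputable def mkHom (P : C) : dual (ω.obj P) ⊗[K] ω.obj P →+ ComatrixRing ω :=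
  ((comatrixRel ω).mkQ ∘ₗ DirectSum.lof K C (FinComatrix ω) P ∘ₗ
    (finComatrixRel ω P).mkQ).toAddMonoidHom

theorem mk_add (P : C) (φ : RDual (ω.obj P)) (p p' : ω.obj P) :
    mk ω P φ (p + p') = mk ω P φ p + mk ω P φ p' :=
  (congrArg (mkHom ω P) (TensorProduct.tmul_add (M := dual (ω.obj P)) φ p p')).trans
    (map_add (mkHom ω P) _ _)

theorem add_mk (P : C) (φ φ' : RDual (ω.obj P)) (p : ω.obj P) :
    mk ω P (φ + φ') p = mk ω P φ p + mk ω P φ' p :=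
  (congrArg (mkHom ω P) (TensorProduct.add_tmul (M := dual (ω.obj P)) φ φ' p)).trans
    (map_add (mkHom ω P) _ _)

theorem mk_zero (P : C) (φ : RDual (ω.obj P)) : mk ω P φ 0 = 0 :=
  (congrArg (mkHom ω P) (TensorProduct.tmul_zero (M := dual (ω.obj P)) _ φ)).trans
    (map_zero (mkHom ω P))

theorem mk_sum (P : C) (φ : RDual (ω.obj P)) {ι : Type*} (s : Finset ι) (p : ι → ω.obj P) :
    mk ω P φ (∑ i ∈ s, p i) = ∑ i ∈ s, mk ω P φ (p i) :=
  map_sum (AddMonoidHom.mk' (mk ω P φ) (mk_add ω P φ)) p s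

theorem sum_mk (P : C) {ι : Type*} (s : Finset ι) (φ : ι → RDual (ω.obj P)) (p : ω.obj P) :
    mk ω P (∑ i ∈ s, φ i) p = ∑ i ∈ s, mk ω P (φ i) p :=
  map_sum (AddMonoidHom.mk' (fun φ => mk ω P φ p) (fun φ φ' => add_mk ω P φ φ' p)) φ s

/-- The defining relation of the comatrix coring. -/
theorem mk_map {P Q : C} (t : P ⟶ Q) (φ : RDual (ω.obj Q)) (p : ω.obj P) :
    mk ω Q φ ((ω.map t).toLin p) = mk ω P (φ ∘ₗ rightLin (ω.map t)) p :=
  (Submodule.Quotient.eq _).2 (Submodule.subset_span ⟨P, Q, t, φ, p, rfl⟩)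

theorem mk_eq_of_map {P Q : C} (t : P ⟶ Q) {φ : RDual (ω.obj Q)} {φ' : RDual (ω.obj P)}
    {q : ω.obj Q} {p : ω.obj P} (hφ : φ ∘ₗ rightLin (ω.map t) = φ') (hp : (ω.map t).toLin p = q) :
    mk ω Q φ q = mk ω P φ' p := by
  rw [← hφ, ← hp, mk_map]

variable {ω}

open Classical in
theorem addHom_ext {X : Type*} [AddCommGroup X] {f g : ComatrixRing ω →+ X}
    (h : ∀ P φ p, f (mk ω P φ p) = g (mk ω P φ p)) : f = g := by
  ext x
  obtain ⟨x, rfl⟩ := Submodule.Quotient.mk_surjective _ x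
  refine DFunLike.congr_fun (DirectSum.addHom_ext
    (f := f.comp (comatrixRel ω).mkQ.toAddMonoidHom)
    (g := g.comp (comatrixRel ω).mkQ.toAddMonoidHom) fun P y => ?_) x
  obtain ⟨y, rfl⟩ := Submodule.Quotient.mk_surjective _ y
  have key : f.comp (mkHom ω P) = g.comp (mkHom ω P) := by
    ext y
    induction y using TensorProduct.induction_on with
    | zero => rw [map_zero, map_zero]
    | tmul φ p => exact h P φ p
    | add y y' hy hy' => rw [map_add, map_add, hy, hy']
  exact DFunLike.congr_fun key y

open Classical in
theorem induction {p : ComatrixRing ω → Prop} (x : ComatrixRing ω) (zero : p 0)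
    (mk : ∀ P φ x, p (mk ω P φ x)) (add : ∀ x y, p x → p y → p (x + y)) : p x := by
  obtain ⟨x, rfl⟩ := Submodule.Quotient.mk_surjective _ x
  induction x using DirectSum.induction_on with
  | zero => exact zero
  | of P y =>
    obtain ⟨y, rfl⟩ := Submodule.Quotient.mk_surjective _ y
    have key : p (mkHom ω P y) := by
      induction y using TensorProduct.induction_on with
      | zero => rw [map_zero]; exact zero
      | tmul φ x => exact mk P φ x
      | add y y' hy hy' => rw [map_add]; exact add _ _ hy hy'
    exact key
  | add x y hx hy => exact add _ _ hx hy

end Mk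

variable [Preadditive C] [Linear K C] (ω : C ⥤ BimodCat.{w, u} K A) [ω.Linear K]

/-- The restriction of `liftAdd` to the component at `P`. -/
noncomputable def liftComponent {X : Type*} [AddCommGroup X] (P : C)
    (f : RDual (ω.obj P) → ω.obj P → X)
    (hl : ∀ φ φ' p, f (φ + φ') p = f φ p + f φ' p) (hr : ∀ φ p p', f φ (p + p') = f φ p + f φ p')
    (h : ∀ (t : P ⟶ P) φ p, f φ ((ω.map t).toLin p) = f (φ ∘ₗ rightLin (ω.map t)) p) :
    FinComatrix ω P →+ X :=
  have hK (k : K) (φ : RDual (ω.obj P)) (p : ω.obj P) : f (k • φ) p = f φ (k • p) := by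
    have h1 := h (k • 𝟙 P) φ p
    rw [ω.map_smul, ω.map_id] at h1
    refine Eq.trans ?_ h1.symm
    congr 1
    ext x
    exact ((φ.restrictScalars K).map_smul k x).symm
  let l := TensorProduct.liftAddHom (M := dual (ω.obj P))
    (AddMonoidHom.ofBiadditive (M := dual (ω.obj P)) f hl hr) hK
  (finComatrixRel ω P).liftQAdd l (fun x hx => by
    refine Submodule.addHom_eq_zero_of_span _ ?_ hx
    rintro k _ ⟨t, φ, p, rfl⟩
    have hs (φ : dual (ω.obj P)) (p : ω.obj P) : l (k • φ ⊗ₜ[K] p) = f (k • φ) p := by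
      rw [TensorProduct.smul_tmul']; rfl
    refine (congrArg l (smul_sub k _ _)).trans ((map_sub l _ _).trans (sub_eq_zero.2 ?_))
    exact (hs φ _).trans ((h t (k • φ) p).trans (hs (φ ∘ₗ rightLin (ω.map t)) p).symm))

open Classical in
/-- The universal property of the comatrix coring as an abelian group. The families of functions
need not be assumed to be balanced over `K`, since this is the relation for `k • 𝟙 P`. -/
noncomputable def liftAdd {X : Type*} [AddCommGroup X] (f : ∀ P, RDual (ω.obj P) → ω.obj P → X)
    (hl : ∀ P φ φ' p, f P (φ + φ') p = f P φ p + f P φ' p)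
    (hr : ∀ P φ p p', f P φ (p + p') = f P φ p + f P φ p')
    (h : ∀ P Q (t : P ⟶ Q) φ p, f Q φ ((ω.map t).toLin p) = f P (φ ∘ₗ rightLin (ω.map t)) p) :
    ComatrixRing ω →+ X :=
  (comatrixRel ω).liftQAdd
    (DirectSum.toAddMonoid fun P => liftComponent ω P (f P) (hl P) (hr P) (h P P))
    (fun x hx => by
      refine Submodule.addHom_eq_zero_of_span _ ?_ hx
      rintro k _ ⟨P, Q, t, φ, p, rfl⟩
      rw [smul_sub, map_sub, sub_eq_zero, ← map_smul, ← map_smul, DirectSum.lof_eq_of,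
        DirectSum.lof_eq_of, DirectSum.toAddMonoid_of, DirectSum.toAddMonoid_of]
      exact h P Q t (k • φ) p)

open Classical in
theorem liftAdd_mk {X : Type*} [AddCommGroup X] (f : ∀ P, RDual (ω.obj P) → ω.obj P → X) (hl hr h)
    (P : C) (φ : RDual (ω.obj P)) (p : ω.obj P) : liftAdd ω f hl hr h (mk ω P φ p) = f P φ p :=
  DirectSum.toAddMonoid_of (fun P => liftComponent ω P (f P) (hl P) (hr P) (h P P)) P
    (FinComatrix.mk ω P φ p)

/-- The counit as an additive map. -/
noncomputable def counitHom : ComatrixRing ω →+ A :=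
  liftAdd ω (fun _ p' p => p' p) (fun _ _ _ _ => rfl) (fun _ p' => map_add p')
    (fun _ _ _ _ _ => rfl)

theorem counitHom_mk (P : C) (p' : RDual (ω.obj P)) (p : ω.obj P) :
    counitHom ω (mk ω P p' p) = p' p := liftAdd_mk ω _ _ _ _ P p' p

end ComatrixRing

end Lift

section Multiplication

variable {K : Type w} {A : Type u} [CommRing K] [Ring A] [Algebra K A]
variable {C : Type u} [Category.{v} C] [MonoidalCategory C]
variable (ω : C ⥤ BimodCat.{w, u} K A) [ω.Monoidal]

namespace ComatrixRing

noncomputable instance : One (ComatrixRing ω) :=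
  ⟨mk ω (𝟙_ C) (fibreLeftMul ω 1) (fibreUnit ω 1)⟩

theorem one_def : (1 : ComatrixRing ω) = mk ω (𝟙_ C) (fibreLeftMul ω 1) (fibreUnit ω 1) := rfl

variable [Preadditive C] [Linear K C] [ω.Linear K]

/-- Left multiplication by the class of `p' ⊗ p`. -/
noncomputable def mkMul (P : C) (p' : RDual (ω.obj P)) (p : ω.obj P) :
    ComatrixRing ω →+ ComatrixRing ω :=
  liftAdd ω (fun Q q' q => mk ω (Q ⊗ P) (fibreStar ω q' p') (fibreTmul ω q p))
    (fun Q q' q'' q => by rw [add_fibreStar, add_mk])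
    (fun Q q' q q'' => by rw [add_fibreTmul, mk_add])
    (fun Q R t r' q => by
      refine mk_eq_of_map ω (t ⊗ₘ 𝟙 P) ?_ ?_
      · rw [fibreStar_comp_map, ω.map_id]; rfl
      · rw [map_fibreTmul, map_id_toLin])

/-- The multiplication as a biadditive map. -/
noncomputable def mulHom : ComatrixRing ω →+ ComatrixRing ω →+ ComatrixRing ω :=
  liftAdd ω (mkMul ω)
    (fun P p' p'' p => addHom_ext fun Q q' q => by
      simp only [AddMonoidHom.add_apply, mkMul, liftAdd_mk, fibreStar_add, add_mk])
    (fun P p' p p'' => addHom_ext fun Q q' q => by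
      simp only [AddMonoidHom.add_apply, mkMul, liftAdd_mk, fibreTmul_add, mk_add])
    (fun P R t r' p => addHom_ext fun Q q' q => by
      simp only [mkMul, liftAdd_mk]
      refine mk_eq_of_map ω (𝟙 Q ⊗ₘ t) ?_ ?_
      · rw [fibreStar_comp_map, ω.map_id]; rfl
      · rw [map_fibreTmul, map_id_toLin])

noncomputable instance : Mul (ComatrixRing ω) := ⟨fun x y => mulHom ω x y⟩

theorem mulHom_apply (x y : ComatrixRing ω) : mulHom ω x y = x * y := rfl

theorem mk_mul_mk (P Q : C) (p' : RDual (ω.obj P)) (p : ω.obj P) (q' : RDual (ω.obj Q))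
    (q : ω.obj Q) : mk ω P p' p * mk ω Q q' q =
      mk ω (Q ⊗ P) (fibreStar ω q' p') (fibreTmul ω q p) := by
  rw [← mulHom_apply, mulHom, liftAdd_mk, mkMul, liftAdd_mk]

/-- Left multiplication by an element of `η (A ⊗ Aᵐᵒᵖ)` is the bimodule action. -/
theorem fibreLeftMul_mul_mk (a b : A) (P : C) (p' : RDual (ω.obj P)) (p : ω.obj P) :
    mk ω (𝟙_ C) (fibreLeftMul ω a) (fibreUnit ω b) * mk ω P p' p =
      mk ω P (a • p') (op b • p) := by
  rw [mk_mul_mk]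
  symm
  refine mk_eq_of_map ω (ρ_ P).hom ?_ (map_rightUnitor_fibreTmul ω b p)
  refine RDual.fibre_ext ω fun x y => ?_
  rw [← fibreUnit_counit ω y]
  simp only [LinearMap.comp_apply, rightLin_apply, fibreStar_apply, fibreLeftMul_apply,
    map_rightUnitor_fibreTmul, LinearMap.smul_apply, RDual.map_op_smul, left_smul_fibreUnit,
    fibreCounit_unit, smul_eq_mul]

/-- Right multiplication by an element of `η (A ⊗ Aᵐᵒᵖ)`. -/
theorem mk_mul_fibreLeftMul (a b : A) (P : C) (p' : RDual (ω.obj P)) (p : ω.obj P) :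
    mk ω P p' p * mk ω (𝟙_ C) (fibreLeftMul ω a) (fibreUnit ω b) =
      mk ω P (p' ∘ₗ DistribSMul.toLinearMap Aᵐᵒᵖ (ω.obj P) a) (b • p) := by
  rw [mk_mul_mk]
  symm
  refine mk_eq_of_map ω (λ_ P).hom ?_ (map_leftUnitor_fibreTmul ω b p)
  refine RDual.fibre_ext ω fun x y => ?_
  rw [← fibreUnit_counit ω x]
  simp only [LinearMap.comp_apply, rightLin_apply, fibreStar_apply, fibreLeftMul_apply,
    map_leftUnitor_fibreTmul, fibreCounit_unit, mul_smul]
  rfl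

noncomputable instance : Ring (ComatrixRing ω) :=
  { (inferInstance : AddCommGroup (ComatrixRing ω)),
    (inferInstance : Mul (ComatrixRing ω)),
    (inferInstance : One (ComatrixRing ω)) with
    left_distrib := fun x y z => map_add (mulHom ω x) y z
    right_distrib := fun x y z => by
      rw [← mulHom_apply, map_add]; rfl
    zero_mul := fun x => by
      rw [← mulHom_apply, map_zero]; rfl
    mul_zero := fun x => map_zero (mulHom ω x)
    one_mul := fun x => by
      refine DFunLike.congr_fun (f := mulHom ω 1) (g := AddMonoidHom.id _)
        (addHom_ext fun P p' p => ?_) x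
      rw [mulHom_apply, one_def, fibreLeftMul_mul_mk, one_smul, op_one, one_smul]
      rfl
    mul_one := fun x => by
      refine DFunLike.congr_fun (f := (mulHom ω).flip 1) (g := AddMonoidHom.id _)
        (addHom_ext fun P p' p => ?_) x
      have hp : p' ∘ₗ DistribSMul.toLinearMap Aᵐᵒᵖ (ω.obj P) (1 : A) = p' :=
        LinearMap.ext fun x => congrArg p' (one_smul A x)
      rw [AddMonoidHom.flip_apply, mulHom_apply, one_def, mk_mul_fibreLeftMul, hp, one_smul]
      rfl
    mul_assoc := fun x y z => by
      have key : (mulHom ω).compr₂ (mulHom ω) =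
          (AddMonoidHom.compHom.flip (mulHom ω)).comp (AddMonoidHom.compHom.comp (mulHom ω)) := by
        refine addHom_ext fun P p' p => addHom_ext fun Q q' q => addHom_ext fun R r' r => ?_
        change mk ω P p' p * mk ω Q q' q * mk ω R r' r =
          mk ω P p' p * (mk ω Q q' q * mk ω R r' r)
        rw [mk_mul_mk, mk_mul_mk, mk_mul_mk, mk_mul_mk]
        refine mk_eq_of_map ω (α_ R Q P).hom ?_ (map_associator_fibreTmul ω r q p)
        refine RDual.fibre_ext₃ ω fun x y z => ?_
        simp only [LinearMap.comp_apply, rightLin_apply, map_associator_fibreTmul,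
          fibreStar_apply, left_smul_fibreTmul]
      exact DFunLike.congr_fun (DFunLike.congr_fun (DFunLike.congr_fun key x) y) z }

end ComatrixRing

end Multiplication

/-! ### The source and target maps -/

section SourceTarget

variable {K : Type w} {A : Type u} [CommRing K] [Ring A] [Algebra K A]
variable {C : Type u} [Category.{v} C] [MonoidalCategory C]
variable (ω : C ⥤ BimodCat.{w, u} K A) [ω.Monoidal]

section Penrose

variable [Preadditive C] [ω.Additive]

theorem map_unitEnd_fibreUnit (t : UnitEnd ω) :
    (ω.map (t : 𝟙_ C ⟶ 𝟙_ C)).toLin (fibreUnit ω 1) =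
      fibreUnit ω (algebraMap (UnitEnd ω) A t) :=
  (fibreUnit_counit ω _).symm

/-- In a Penrose category the two actions of the endomorphisms of the unit object on `ω(P)`
coincide. -/
theorem IsPenrose.smul_eq (h : IsPenrose C) (t : UnitEnd ω) (P : C) (x : ω.obj P) :
    op (algebraMap (UnitEnd ω) A t) • x = algebraMap (UnitEnd ω) A t • x := by
  have key (s : 𝟙_ C ⟶ 𝟙_ C) (a : A)
      (hs : (ω.map s).toLin (fibreUnit ω 1) = fibreUnit ω a) : op a • x = a • x := by
    have h1 := congrArg (fun f => (ω.map f).toLin x) (h P P (𝟙 P) s)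
    simp only [map_comp_toLin, map_leftUnitor_inv_apply, map_rightUnitor_inv_apply, map_fibreTmul,
      map_id_toLin, hs, map_leftUnitor_fibreTmul, map_rightUnitor_fibreTmul] at h1
    exact h1.symm
  exact key t _ (map_unitEnd_fibreUnit ω t)

end Penrose

namespace ComatrixRing

/-- The class of `r ↦ a r` tensored with `b`, in the component at the unit object. -/
noncomputable def base (a b : A) : ComatrixRing ω :=
  mk ω (𝟙_ C) (fibreLeftMul ω a) (fibreUnit ω b)

theorem fibreLeftMul_add (a a' : A) :
    fibreLeftMul ω (a + a') = fibreLeftMul ω a + fibreLeftMul ω a' :=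
  LinearMap.ext fun _ => add_mul _ _ _

theorem base_add_left (a a' b : A) : base ω (a + a') b = base ω a b + base ω a' b := by
  rw [base, fibreLeftMul_add, add_mk]; rfl

theorem base_add_right (a b b' : A) : base ω a (b + b') = base ω a b + base ω a b' := by
  rw [base, fibreUnit_add, mk_add]; rfl

section

variable [Preadditive C]

theorem base_unitEnd [ω.Additive] (t : UnitEnd ω) :
    base ω (algebraMap (UnitEnd ω) A t) 1 = base ω 1 (algebraMap (UnitEnd ω) A t) := by
  symm
  refine mk_eq_of_map ω (t : 𝟙_ C ⟶ 𝟙_ C) (RDual.unit_ext ω ?_) (map_unitEnd_fibreUnit ω t)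
  simp only [LinearMap.comp_apply, rightLin_apply, map_unitEnd_fibreUnit, fibreLeftMul_apply,
    fibreCounit_unit, one_mul, mul_one]

variable [Linear K C] [ω.Linear K]

theorem base_mul_mk (a b : A) (P : C) (p' : RDual (ω.obj P)) (p : ω.obj P) :
    base ω a b * mk ω P p' p = mk ω P (a • p') (op b • p) :=
  fibreLeftMul_mul_mk ω a b P p' p

theorem mk_mul_base (a b : A) (P : C) (p' : RDual (ω.obj P)) (p : ω.obj P) :
    mk ω P p' p * base ω a b =
      mk ω P (p' ∘ₗ DistribSMul.toLinearMap Aᵐᵒᵖ (ω.obj P) a) (b • p) :=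
  mk_mul_fibreLeftMul ω a b P p' p

theorem base_mul_base (a b a' b' : A) : base ω a b * base ω a' b' = base ω (a * a') (b' * b) := by
  rw [base, base, fibreLeftMul_mul_mk, right_smul_fibreUnit, base]
  congr 1
  exact LinearMap.ext fun x => (mul_assoc a a' _).symm

variable [ω.Additive]

theorem base_unitEnd_commute [hP : Fact (IsPenrose C)] (t : UnitEnd ω) (x : ComatrixRing ω) :
    base ω (algebraMap (UnitEnd ω) A t) 1 * x = x * base ω (algebraMap (UnitEnd ω) A t) 1 := by
  induction x using ComatrixRing.induction with
  | zero => rw [mul_zero, zero_mul]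
  | mk P p' p =>
    rw [base_mul_mk, mk_mul_base, op_one, one_smul, one_smul]
    congr 1
    ext x
    change _ = p' (algebraMap (UnitEnd ω) A t • x)
    rw [← IsPenrose.smul_eq ω hP.out, RDual.map_op_smul]
    exact Algebra.commutes t (p' x)
  | add x y hx hy => rw [mul_add, add_mul, hx, hy]

/-- The source map. -/
noncomputable def srcHom : A →+* ComatrixRing ω where
  toFun a := base ω a 1
  map_one' := rfl
  map_mul' a b := by rw [base_mul_base, one_mul]
  map_zero' := by simpa using base_add_left ω 0 0 1
  map_add' a b := base_add_left ω a b 1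

/-- The target map. -/
noncomputable def tgtHom : Aᵐᵒᵖ →+* ComatrixRing ω where
  toFun b := base ω 1 (unop b)
  map_one' := rfl
  map_mul' a b := by rw [base_mul_base, one_mul]; rfl
  map_zero' := by simpa using base_add_right ω 1 0 0
  map_add' a b := base_add_right ω 1 (unop a) (unop b)

/-- The endomorphisms of the unit object are central in the comatrix coring of a fibre functor on a
Penrose category. The Penrose condition is wrapped in `Fact` so that this can be an instance. -/
noncomputable instance [Fact (IsPenrose C)] : Algebra (UnitEnd ω) (ComatrixRing ω) :=
  ((srcHom ω).comp (algebraMap (UnitEnd ω) A)).toAlgebra' (base_unitEnd_commute ω)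

variable [Fact (IsPenrose C)]

/-- The structure of an `A ⊗ Aᵐᵒᵖ`-ring on the comatrix coring. -/
noncomputable def baseHom : A ⊗[UnitEnd ω] Aᵐᵒᵖ →ₐ[UnitEnd ω] ComatrixRing ω :=
  Algebra.TensorProduct.lift
    ({ srcHom ω with commutes' := fun _ => rfl } : A →ₐ[UnitEnd ω] ComatrixRing ω)
    ({ tgtHom ω with
        commutes' := fun t => (base_unitEnd ω t).symm } : Aᵐᵒᵖ →ₐ[UnitEnd ω] ComatrixRing ω)
    (fun a b => by
      change base ω a 1 * base ω 1 (unop b) = base ω 1 (unop b) * base ω a 1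
      rw [base_mul_base, base_mul_base, one_mul, one_mul, mul_one, mul_one])

theorem baseHom_tmul (a b : A) : baseHom ω (a ⊗ₜ op b) = base ω a b := by
  refine (Algebra.TensorProduct.lift_tmul _ _ _ _ _).trans ?_
  change base ω a 1 * base ω 1 b = base ω a b
  rw [base_mul_base, mul_one, mul_one]

theorem src_baseHom (a : A) : src (baseHom ω) a = base ω a 1 := baseHom_tmul ω a 1

theorem tgt_baseHom (a : A) : tgt (baseHom ω) a = base ω 1 a := baseHom_tmul ω 1 a

end

end ComatrixRing

end SourceTarget

/-! ### Dual bases -/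

section DualBases

variable {K : Type w} {A : Type u} [CommRing K] [Ring A] [Algebra K A]

/-- A finite dual basis of the right module `M`, indexed by an arbitrary finite type. -/
def IsFiniteDualBasis (M : BimodCat.{w, u} K A) {ι : Type*} [Fintype ι] (b : ι → M)
    (φ : ι → RDual M) : Prop :=
  ∀ x : M, ∑ i, op (φ i x) • b i = x

theorem exists_isFiniteDualBasis (M : BimodCat.{w, u} K A) [Module.Finite Aᵐᵒᵖ M]
    [Module.Projective Aᵐᵒᵖ M] :
    ∃ (n : ℕ) (b : Fin n → M) (φ : Fin n → RDual M), IsFiniteDualBasis M b φ := by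
  obtain ⟨n, f, g, -, -, hfg⟩ := Module.Finite.exists_comp_eq_id_of_projective Aᵐᵒᵖ M
  refine ⟨n, fun i => f (Pi.single i 1), fun i =>
    { toFun := fun x => unop (g x i)
      map_add' := fun x y => by rw [map_add]; rfl
      map_smul' := fun a x => by rw [map_smul]; rfl }, fun x => ?_⟩
  have h1 : ∑ i, op (unop (g x i)) • f (Pi.single i 1) = f (g x) := by
    conv_rhs => rw [pi_eq_sum_univ' (g x)]
    rw [map_sum]
    refine Finset.sum_congr rfl fun i _ => ?_
    rw [op_unop, ← map_smul]
  exact h1.trans (LinearMap.congr_fun hfg x)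

variable {M N : BimodCat.{w, u} K A} {ι κ : Type*} [Fintype ι] [Fintype κ]

/-- The coordinates of `φ ∘ g`. -/
theorem IsFiniteDualBasis.sum_apply_smul {b : ι → M} {φ : ι → RDual M}
    (h : IsFiniteDualBasis M b φ) (g : M →ₗ[Aᵐᵒᵖ] N) (ψ : RDual N) :
    ∑ i, ψ (g (b i)) • φ i = ψ ∘ₗ g := by
  ext x
  rw [LinearMap.sum_apply, LinearMap.comp_apply]
  conv_rhs => rw [← h x, map_sum, map_sum]
  refine Finset.sum_congr rfl fun i _ => ?_
  rw [map_smul, RDual.map_op_smul]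
  rfl

/-- The canonical elements of dual bases are natural in right linear maps:
`∑ g(eᵢ) ⊗ eᵢ* = ∑ fⱼ ⊗ (fⱼ* ∘ g)` in `N ⊗_A M*`, here in the form of balanced maps. -/
theorem IsFiniteDualBasis.sum_balanced {X : Type*} [AddCommGroup X] {b : ι → M}
    {φ : ι → RDual M} {c : κ → N} {ψ : κ → RDual N} (hb : IsFiniteDualBasis M b φ)
    (hc : IsFiniteDualBasis N c ψ) (g : M →ₗ[Aᵐᵒᵖ] N) (f : N →+ RDual M →+ X)
    (hf : ∀ (n : N) (a : A) (χ : RDual M), f (op a • n) χ = f n (a • χ)) :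
    ∑ i, f (g (b i)) (φ i) = ∑ j, f (c j) (ψ j ∘ₗ g) := by
  have h1 (i : ι) : f (g (b i)) (φ i) = ∑ j, f (c j) (ψ j (g (b i)) • φ i) := by
    conv_lhs => rw [← hc (g (b i)), map_sum, AddMonoidHom.finsetSum_apply]
    exact Finset.sum_congr rfl fun j _ => hf _ _ _
  rw [Finset.sum_congr rfl fun i _ => h1 i, Finset.sum_comm]
  refine Finset.sum_congr rfl fun j _ => ?_
  rw [← map_sum, hb.sum_apply_smul]

variable {C : Type u} [Category.{v} C] [MonoidalCategory C]
variable (ω : C ⥤ BimodCat.{w, u} K A) [ω.Monoidal]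

theorem isFiniteDualBasis_unit : IsFiniteDualBasis (ω.obj (𝟙_ C))
    (fun _ : Unit => fibreUnit ω 1) (fun _ => fibreLeftMul ω 1) := fun x => by
  rw [Finset.univ_unique, Finset.sum_singleton, right_smul_fibreUnit, fibreLeftMul_apply, one_mul,
    one_mul, fibreUnit_counit]

theorem IsFiniteDualBasis.fibreTmul {P Q : C} {b : ι → ω.obj P} {φ : ι → RDual (ω.obj P)}
    {c : κ → ω.obj Q} {ψ : κ → RDual (ω.obj Q)} (hb : IsFiniteDualBasis (ω.obj P) b φ)
    (hc : IsFiniteDualBasis (ω.obj Q) c ψ) :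
    IsFiniteDualBasis (ω.obj (P ⊗ Q)) (fun i : ι × κ => fibreTmul ω (b i.1) (c i.2))
      (fun i => fibreStar ω (φ i.1) (ψ i.2)) := by
  intro z
  induction z using fibreTmul_induction with
  | zero => simp
  | tmul x y =>
    simp only [fibreStar_apply, right_smul_fibreTmul, Fintype.sum_prod_type]
    have h1 (i : ι) : ∑ j, _root_.fibreTmul ω (b i) (op (ψ j (φ i x • y)) • c j) =
        _root_.fibreTmul ω (op (φ i x) • b i) y := by
      rw [fibreTmul_balanced]
      conv_rhs => rw [← hc (φ i x • y)]
      exact (map_sum (AddMonoidHom.mk' (_root_.fibreTmul ω (b i)) (fibreTmul_add ω _)) _ _).symm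
    rw [Finset.sum_congr rfl fun i _ => h1 i]
    conv_rhs => rw [← hb x]
    exact (map_sum (AddMonoidHom.mk' (_root_.fibreTmul ω · y)
      (fun s t => add_fibreTmul ω s t y)) _ _).symm
  | add z z' hz hz' =>
    conv_rhs => rw [← hz, ← hz']
    rw [← Finset.sum_add_distrib]
    refine Finset.sum_congr rfl fun i _ => ?_
    rw [map_add]
    exact add_smul (op _) (op _) _

end DualBases

/-! ### The comatrix coring as a left bialgebroid -/

section Coring

variable {K : Type w} {A : Type u} [CommRing K] [Ring A] [Algebra K A]
variable {C : Type u} [Category.{v} C] [MonoidalCategory C] [Preadditive C] [Linear K C]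
variable (ω : C ⥤ BimodCat.{w, u} K A) [ω.Monoidal] [ω.Additive] [ω.Linear K]
variable [Fact (IsPenrose C)]

namespace ComatrixRing

open ModuleOver

/-- The comatrix coring as an `A`-bimodule over the endomorphisms of the unit object. -/
noncomputable abbrev bimod : BimodCat.{v, u} (UnitEnd ω) A := ringBimod (baseHom ω)

theorem bimod_left_smul (a : A) (P : C) (p' : RDual (ω.obj P)) (p : ω.obj P) :
    (bimod ω).leftModule.toSMul.smul a (mk ω P p' p) = mk ω P (a • p') p := by
  change src (baseHom ω) a * mk ω P p' p = _
  rw [src_baseHom, base_mul_mk, op_one, one_smul]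

theorem bimod_right_smul (a : A) (P : C) (p' : RDual (ω.obj P)) (p : ω.obj P) :
    (bimod ω).rightModule.toSMul.smul (op a) (mk ω P p' p) = mk ω P p' (op a • p) := by
  change tgt (baseHom ω) a * mk ω P p' p = _
  rw [tgt_baseHom, base_mul_mk, one_smul]

theorem bimod_hom_ext {N : BimodCat.{v, u} (UnitEnd ω) A} {f g : bimod ω ⟶ N}
    (h : ∀ P p' p, f.toLin (mk ω P p' p) = g.toLin (mk ω P p' p)) : f = g :=
  hom_ext fun x => DFunLike.congr_fun (addHom_ext (ω := ω) (f := f.toLin.toAddMonoidHom)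
    (g := g.toLin.toAddMonoidHom) h) x

/-- The elements `[p' ⊗ n] ⊗ [χ ⊗ p]` as a biadditive function of `n` and `χ`. -/
noncomputable def tmulMk {P Q : C} (p' : RDual (ω.obj Q)) (p : ω.obj P) :
    ω.obj Q →+ RDual (ω.obj P) →+ Tensor (bimod ω) (bimod ω) :=
  AddMonoidHom.ofBiadditive
    (fun n χ => Tensor.tmul (M := bimod ω) (N := bimod ω) (mk ω Q p' n) (mk ω P χ p))
    (fun n n' χ => by rw [mk_add]; exact Tensor.add_tmul (M := bimod ω) (N := bimod ω) _ _ _)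
    (fun n χ χ' => by rw [add_mk]; exact Tensor.tmul_add (M := bimod ω) (N := bimod ω) _ _ _)

theorem tmulMk_balanced {P Q : C} (p' : RDual (ω.obj Q)) (p : ω.obj P) (n : ω.obj Q) (a : A)
    (χ : RDual (ω.obj P)) : tmulMk ω p' p (op a • n) χ = tmulMk ω p' p n (a • χ) := by
  change Tensor.tmul (M := bimod ω) (N := bimod ω) (mk ω Q p' (op a • n)) (mk ω P χ p) =
    Tensor.tmul (M := bimod ω) (N := bimod ω) (mk ω Q p' n) (mk ω P (a • χ) p)
  rw [← bimod_left_smul, ← bimod_right_smul]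
  exact Tensor.smul_tmul (M := bimod ω) (N := bimod ω) _ a _

/-- A choice of a finite dual basis of every `ω(P)`. -/
structure DualBases where
  /-- The size of the basis. -/
  card : C → ℕ
  /-- The elements of the basis. -/
  basis : ∀ P, Fin (card P) → ω.obj P
  /-- The coordinate functionals. -/
  coord : ∀ P, Fin (card P) → RDual (ω.obj P)
  isFiniteDualBasis : ∀ P, IsFiniteDualBasis (ω.obj P) (basis P) (coord P)

variable {ω} (D : DualBases ω)

/-- The comultiplication as an additive map. -/
noncomputable def comulHom : ComatrixRing ω →+ Tensor (bimod ω) (bimod ω) :=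
  liftAdd ω (fun P p' p => ∑ i, tmulMk ω p' p (D.basis P i) (D.coord P i))
    (fun P p' p'' p => by
      rw [← Finset.sum_add_distrib]
      refine Finset.sum_congr rfl fun i _ => ?_
      refine Eq.trans ?_ (Tensor.add_tmul (M := bimod ω) (N := bimod ω) _ _ _)
      rw [← add_mk]; rfl)
    (fun P p' p p'' => by
      rw [← Finset.sum_add_distrib]
      refine Finset.sum_congr rfl fun i _ => ?_
      refine Eq.trans ?_ (Tensor.tmul_add (M := bimod ω) (N := bimod ω) _ _ _)
      rw [← mk_add]; rfl)
    (fun P Q t q' p => by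
      have h := (D.isFiniteDualBasis P).sum_balanced (D.isFiniteDualBasis Q)
        (rightLin (ω.map t)) (tmulMk ω q' p) (tmulMk_balanced ω q' p)
      refine Eq.trans (Finset.sum_congr rfl fun j _ => ?_) (h.symm.trans
        (Finset.sum_congr rfl fun i _ => ?_))
      · exact congrArg (Tensor.tmul (M := bimod ω) (N := bimod ω) _) (mk_map ω t _ p)
      · exact congrArg (Tensor.tmul (M := bimod ω) (N := bimod ω) · _) (mk_map ω t q' _))

/-- The comultiplication may be computed with any dual basis. -/
theorem comulHom_mk {ι : Type*} [Fintype ι] {P : C} {b : ι → ω.obj P} {φ : ι → RDual (ω.obj P)}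
    (hb : IsFiniteDualBasis (ω.obj P) b φ) (p' : RDual (ω.obj P)) (p : ω.obj P) :
    comulHom D (mk ω P p' p) = ∑ i,
      Tensor.tmul (M := bimod ω) (N := bimod ω) (mk ω P p' (b i)) (mk ω P (φ i) p) := by
  rw [comulHom, liftAdd_mk]
  exact (D.isFiniteDualBasis P).sum_balanced hb LinearMap.id (tmulMk ω p' p)
    (tmulMk_balanced ω p' p)

/-- The comultiplication as a map of bimodules. -/
noncomputable def comul : bimod ω ⟶ bimod ω ⊗ bimod ω :=
  homOfAdd (M := bimod ω) (N := tensor (bimod ω) (bimod ω)) (comulHom D)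
    (fun a x => by
      refine DFunLike.congr_fun (addHom_ext (ω := ω)
        (f := (comulHom D).comp (AddMonoidHom.mulLeft (src (baseHom ω) a)))
        (g := (DistribSMul.toAddMonoidHom _ a).comp (comulHom D)) fun P p' p => ?_) x
      change comulHom D (src (baseHom ω) a * mk ω P p' p) = a • comulHom D (mk ω P p' p)
      rw [src_baseHom, base_mul_mk, op_one, one_smul, comulHom_mk D (D.isFiniteDualBasis P),
        comulHom_mk D (D.isFiniteDualBasis P), Finset.smul_sum]
      refine Finset.sum_congr rfl fun i _ => ?_
      rw [← bimod_left_smul]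
      rfl)
    (fun a x => by
      refine DFunLike.congr_fun (addHom_ext (ω := ω)
        (f := (comulHom D).comp (AddMonoidHom.mulLeft (tgt (baseHom ω) a)))
        (g := (DistribSMul.toAddMonoidHom _ (op a)).comp (comulHom D)) fun P p' p => ?_) x
      change comulHom D (tgt (baseHom ω) a * mk ω P p' p) = op a • comulHom D (mk ω P p' p)
      rw [tgt_baseHom, base_mul_mk, one_smul, comulHom_mk D (D.isFiniteDualBasis P),
        comulHom_mk D (D.isFiniteDualBasis P), Finset.smul_sum]
      refine Finset.sum_congr rfl fun i _ => ?_
      rw [← bimod_right_smul]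
      rfl)

theorem comul_mk {ι : Type*} [Fintype ι] {P : C} {b : ι → ω.obj P} {φ : ι → RDual (ω.obj P)}
    (hb : IsFiniteDualBasis (ω.obj P) b φ) (p' : RDual (ω.obj P)) (p : ω.obj P) :
    (comul D).toLin (mk ω P p' p) = ∑ i,
      Tensor.tmul (M := bimod ω) (N := bimod ω) (mk ω P p' (b i)) (mk ω P (φ i) p) :=
  comulHom_mk D hb p' p

variable (ω) in
/-- The counit as a map of bimodules. -/
noncomputable def counit : bimod ω ⟶ 𝟙_ (BimodCat.{v, u} (UnitEnd ω) A) :=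
  homOfAdd (M := bimod ω) (N := unit (UnitEnd ω) A) (counitHom ω)
    (fun a x => by
      refine DFunLike.congr_fun (addHom_ext (ω := ω)
        (f := (counitHom ω).comp (AddMonoidHom.mulLeft (src (baseHom ω) a)))
        (g := (AddMonoidHom.mulLeft a).comp (counitHom ω)) fun P p' p => ?_) x
      change counitHom ω (src (baseHom ω) a * mk ω P p' p) = a * counitHom ω (mk ω P p' p)
      rw [src_baseHom, base_mul_mk, op_one, one_smul, counitHom_mk, counitHom_mk]
      rfl)
    (fun a x => by
      refine DFunLike.congr_fun (addHom_ext (ω := ω)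
        (f := (counitHom ω).comp (AddMonoidHom.mulLeft (tgt (baseHom ω) a)))
        (g := (AddMonoidHom.mulRight a).comp (counitHom ω)) fun P p' p => ?_) x
      change counitHom ω (tgt (baseHom ω) a * mk ω P p' p) = counitHom ω (mk ω P p' p) * a
      rw [tgt_baseHom, base_mul_mk, one_smul, counitHom_mk, counitHom_mk, RDual.map_op_smul])

theorem counit_mk (P : C) (p' : RDual (ω.obj P)) (p : ω.obj P) :
    (counit ω).toLin (mk ω P p' p) = p' p := counitHom_mk ω P p' p

/-- The comatrix coring. -/
noncomputable abbrev comonObj : ComonObj (bimod ω) where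
  counit := counit ω
  comul := comul D
  counit_comul := bimod_hom_ext ω fun P p' p => by
    have h := (D.isFiniteDualBasis P).sum_apply_smul LinearMap.id p'
    change (counit ω ▷ bimod ω).toLin ((comul D).toLin (mk ω P p' p)) =
      Tensor.tmul (M := unit (UnitEnd ω) A) (N := bimod ω) (1 : A) (mk ω P p' p)
    rw [comul_mk D (D.isFiniteDualBasis P), map_sum]
    conv_rhs => rw [← LinearMap.comp_id p', ← h, sum_mk]
    refine Eq.trans ?_
      (Tensor.tmul_sum (M := unit (UnitEnd ω) A) (N := bimod ω) _ (1 : A) _).symm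
    refine Finset.sum_congr rfl fun i _ => ?_
    change Tensor.tmul (M := unit (UnitEnd ω) A) (N := bimod ω)
      ((counit ω).toLin (mk ω P p' (D.basis P i))) _ = _
    rw [counit_mk, ← bimod_left_smul]
    refine Eq.trans ?_ (Tensor.smul_tmul (M := unit (UnitEnd ω) A) (N := bimod ω) (1 : A) _ _)
    exact congrArg (Tensor.tmul (M := unit (UnitEnd ω) A) (N := bimod ω) · _) (one_mul _).symm
  comul_counit := bimod_hom_ext ω fun P p' p => by
    have h := D.isFiniteDualBasis P p
    change (bimod ω ◁ counit ω).toLin ((comul D).toLin (mk ω P p' p)) =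
      Tensor.tmul (M := bimod ω) (N := unit (UnitEnd ω) A) (mk ω P p' p) (1 : A)
    rw [comul_mk D (D.isFiniteDualBasis P), map_sum]
    conv_rhs => rw [← h, mk_sum]
    refine Eq.trans ?_
      (Tensor.sum_tmul (M := bimod ω) (N := unit (UnitEnd ω) A) _ _ (1 : A)).symm
    refine Finset.sum_congr rfl fun i _ => ?_
    change Tensor.tmul (M := bimod ω) (N := unit (UnitEnd ω) A) _
      ((counit ω).toLin (mk ω P (D.coord P i) p)) = _
    rw [counit_mk, ← bimod_right_smul]
    refine Eq.trans ?_ (Tensor.smul_tmul (M := bimod ω) (N := unit (UnitEnd ω) A) _ _ (1 : A)).symm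
    exact congrArg (Tensor.tmul (M := bimod ω) (N := unit (UnitEnd ω) A) _) (mul_one _).symm
  comul_assoc := bimod_hom_ext ω fun P p' p => by
    change (bimod ω ◁ comul D).toLin ((comul D).toLin (mk ω P p' p)) =
      (α_ (bimod ω) (bimod ω) (bimod ω)).hom.toLin ((comul D ▷ bimod ω).toLin
        ((comul D).toLin (mk ω P p' p)))
    rw [comul_mk D (D.isFiniteDualBasis P), map_sum, map_sum, map_sum]
    have h1 (i) : (bimod ω ◁ comul D).toLin (Tensor.tmul (M := bimod ω) (N := bimod ω)
        (mk ω P p' (D.basis P i)) (mk ω P (D.coord P i) p)) =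
        ∑ j, Tensor.tmul (M := bimod ω) (N := tensor (bimod ω) (bimod ω))
          (mk ω P p' (D.basis P i)) (Tensor.tmul (M := bimod ω) (N := bimod ω)
            (mk ω P (D.coord P i) (D.basis P j)) (mk ω P (D.coord P j) p)) := by
      refine Eq.trans ?_ (Tensor.tmul_sum (M := bimod ω) (N := tensor (bimod ω) (bimod ω)) _ _ _)
      exact congrArg (Tensor.tmul (M := bimod ω) (N := tensor (bimod ω) (bimod ω)) _)
        (comul_mk D (D.isFiniteDualBasis P) _ _)
    have h2 (j) : (α_ (bimod ω) (bimod ω) (bimod ω)).hom.toLin ((comul D ▷ bimod ω).toLin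
        (Tensor.tmul (M := bimod ω) (N := bimod ω)
        (mk ω P p' (D.basis P j)) (mk ω P (D.coord P j) p))) =
        ∑ i, Tensor.tmul (M := bimod ω) (N := tensor (bimod ω) (bimod ω))
          (mk ω P p' (D.basis P i)) (Tensor.tmul (M := bimod ω) (N := bimod ω)
            (mk ω P (D.coord P i) (D.basis P j)) (mk ω P (D.coord P j) p)) := by
      have h3 : (comul D ▷ bimod ω).toLin (Tensor.tmul (M := bimod ω) (N := bimod ω)
          (mk ω P p' (D.basis P j)) (mk ω P (D.coord P j) p)) =
          ∑ i, Tensor.tmul (M := tensor (bimod ω) (bimod ω)) (N := bimod ω)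
            (Tensor.tmul (M := bimod ω) (N := bimod ω) (mk ω P p' (D.basis P i))
              (mk ω P (D.coord P i) (D.basis P j))) (mk ω P (D.coord P j) p) := by
        refine Eq.trans ?_
          (Tensor.sum_tmul (M := tensor (bimod ω) (bimod ω)) (N := bimod ω) _ _ _)
        exact congrArg (Tensor.tmul (M := tensor (bimod ω) (bimod ω)) (N := bimod ω) · _)
          (comul_mk D (D.isFiniteDualBasis P) _ _)
      rw [h3, map_sum]
      rfl
    rw [Finset.sum_congr rfl fun i _ => h1 i, Finset.sum_congr rfl fun j _ => h2 j]
    exact Finset.sum_comm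

theorem isTakeuchi : IsTakeuchi (comonObj D) := fun v a => by
  refine DFunLike.congr_fun (addHom_ext (ω := ω)
    (f := (tensorEval (regular (baseHom ω)) (regular (baseHom ω))
      (tgt (baseHom ω) a) (1 : ComatrixRing ω)).comp (comulHom D))
    (g := (tensorEval (regular (baseHom ω)) (regular (baseHom ω))
      (1 : ComatrixRing ω) (src (baseHom ω) a)).comp (comulHom D)) fun P p' p => ?_) v
  rw [AddMonoidHom.comp_apply, AddMonoidHom.comp_apply, comulHom_mk D (D.isFiniteDualBasis P),
    map_sum, map_sum]
  have h := (D.isFiniteDualBasis P).sum_balanced (D.isFiniteDualBasis P)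
    (DistribSMul.toLinearMap Aᵐᵒᵖ (ω.obj P) a) (tmulMk ω p' p) (tmulMk_balanced ω p' p)
  refine Eq.trans (Finset.sum_congr rfl fun i _ => ?_) (h.trans
    (Finset.sum_congr rfl fun j _ => ?_))
  · change Tensor.tmul (M := bimod ω) (N := bimod ω)
      (mk ω P p' (D.basis P i) * tgt (baseHom ω) a) (mk ω P (D.coord P i) p * 1) =
      Tensor.tmul (M := bimod ω) (N := bimod ω)
        (mk ω P p' (a • D.basis P i)) (mk ω P (D.coord P i) p)
    have hp : p' ∘ₗ DistribSMul.toLinearMap Aᵐᵒᵖ (ω.obj P) (1 : A) = p' :=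
      LinearMap.ext fun x => congrArg p' (one_smul A x)
    rw [tgt_baseHom, mk_mul_base, mul_one, hp]
  · change _ = Tensor.tmul (M := bimod ω) (N := bimod ω)
      (mk ω P p' (D.basis P j) * 1) (mk ω P (D.coord P j) p * src (baseHom ω) a)
    rw [src_baseHom, mk_mul_base, mul_one, one_smul]
    rfl

theorem isTimesBialgebra : IsTimesBialgebra (comonObj D) where
  takeuchi := isTakeuchi D
  comul_mul v v' := by
    change comulHom D (v * v') = (isTakeuchi D).tensorAct (regular (baseHom ω))
      (regular (baseHom ω)) v (comulHom D v')
    induction v using ComatrixRing.induction with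
    | zero =>
      have h0 : (isTakeuchi D).tensorAct (regular (baseHom ω)) (regular (baseHom ω)) 0 = 0 := by
        have := (isTakeuchi D).tensorAct_add (regular (baseHom ω)) (regular (baseHom ω)) 0 0
        rwa [add_zero, left_eq_add] at this
      rw [h0, zero_mul, map_zero]; rfl
    | add x y hx hy => rw [add_mul, map_add, hx, hy, IsTakeuchi.tensorAct_add]; rfl
    | mk P p' p =>
    induction v' using ComatrixRing.induction with
    | zero => rw [mul_zero, map_zero, map_zero]
    | add x y hx hy => rw [mul_add, map_add, hx, hy, map_add, map_add]
    | mk Q q' q =>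
      rw [mk_mul_mk, comulHom_mk D ((D.isFiniteDualBasis Q).fibreTmul ω (D.isFiniteDualBasis P)),
        comulHom_mk D (D.isFiniteDualBasis Q), map_sum, Fintype.sum_prod_type]
      refine Finset.sum_congr rfl fun j _ => ?_
      refine Eq.trans ?_ (IsTakeuchi.tensorAct_tmul _ _ _ _ _ _).symm
      refine Eq.trans ?_ (congrArg (tensorEval (regular (baseHom ω)) (regular (baseHom ω)) _ _)
        (comulHom_mk D (D.isFiniteDualBasis P) p' p).symm)
      rw [map_sum]
      refine Finset.sum_congr rfl fun i _ => ?_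
      change _ = Tensor.tmul (M := bimod ω) (N := bimod ω)
        (mk ω P p' (D.basis P i) * mk ω Q q' (D.basis Q j))
        (mk ω P (D.coord P i) p * mk ω Q (D.coord Q j) q)
      rw [mk_mul_mk, mk_mul_mk]
  comul_one := by
    change comulHom D (1 : ComatrixRing ω) = _
    rw [one_def, comulHom_mk D (isFiniteDualBasis_unit ω), Finset.univ_unique,
      Finset.sum_singleton]
  counit_one := by
    change counitHom ω (1 : ComatrixRing ω) = (1 : A)
    rw [one_def, counitHom_mk, fibreLeftMul_apply, fibreCounit_unit, mul_one]
  counit_mul_src v v' := by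
    change counitHom ω (v * v') = counitHom ω (v * src (baseHom ω) (counitHom ω v'))
    rw [src_baseHom]
    induction v using ComatrixRing.induction with
    | zero => rw [zero_mul, zero_mul]
    | add x y hx hy => rw [add_mul, add_mul, map_add, map_add, hx, hy]
    | mk P p' p =>
    induction v' using ComatrixRing.induction with
    | zero =>
      have h0 : base ω 0 1 = 0 := map_zero (srcHom ω)
      rw [mul_zero, map_zero, h0, mul_zero]
      exact (map_zero (counitHom ω)).symm
    | add x y hx hy =>
      rw [mul_add, map_add, map_add, hx, hy, base_add_left, mul_add, map_add]
    | mk Q q' q =>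
      rw [mk_mul_mk, mk_mul_base, counitHom_mk, counitHom_mk, counitHom_mk, fibreStar_apply,
        one_smul]
      rfl
  counit_mul_tgt v v' := by
    change counitHom ω (v * v') = counitHom ω (v * tgt (baseHom ω) (counitHom ω v'))
    rw [tgt_baseHom]
    induction v using ComatrixRing.induction with
    | zero => rw [zero_mul, zero_mul]
    | add x y hx hy => rw [add_mul, add_mul, map_add, map_add, hx, hy]
    | mk P p' p =>
    induction v' using ComatrixRing.induction with
    | zero => rw [mul_zero, map_zero, mk_mul_base, zero_smul, mk_zero, map_zero]
    | add x y hx hy =>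
      rw [mul_add, map_add, map_add, hx, hy, base_add_right, mul_add, map_add]
    | mk Q q' q =>
      rw [mk_mul_mk, mk_mul_base, counitHom_mk, counitHom_mk, counitHom_mk, fibreStar_apply]
      exact congrArg p' (one_smul A _).symm

end ComatrixRing

end Coring

/-! ### The pairing of an object and its dual -/

section Pairing

variable {K : Type w} {A : Type u} [CommRing K] [Ring A] [Algebra K A]
variable {C : Type u} [Category.{v} C] [MonoidalCategory C]
variable (ω : C ⥤ BimodCat.{w, u} K A) [ω.Monoidal]

section Basic

variable {P D : C} [ExactPairing P D]

/-- The pairing `ω(D) × ω(P) → A` induced by the evaluation of a right dual `D` of `P`. -/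
def pairing (y : ω.obj D) (x : ω.obj P) : A :=
  fibreCounit ω ((ω.map (ε_ P D)).toLin (fibreTmul ω y x))

theorem map_evaluation_fibreTmul (y : ω.obj D) (x : ω.obj P) :
    (ω.map (ε_ P D)).toLin (fibreTmul ω y x) = fibreUnit ω (pairing ω y x) :=
  (fibreUnit_counit ω _).symm

theorem fibreCounit_left_smul (a : A) (x : ω.obj (𝟙_ C)) :
    fibreCounit ω (a • x) = a * fibreCounit ω x :=
  toLin_left (Functor.OplaxMonoidal.η ω) a x

theorem fibreCounit_right_smul (a : A) (x : ω.obj (𝟙_ C)) :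
    fibreCounit ω (op a • x) = fibreCounit ω x * a :=
  toLin_right (Functor.OplaxMonoidal.η ω) a x

theorem pairing_add_left (y y' : ω.obj D) (x : ω.obj P) :
    pairing ω (y + y') x = pairing ω y x + pairing ω y' x := by
  rw [pairing, add_fibreTmul, map_add]
  exact map_add (Functor.OplaxMonoidal.η ω).toLin _ _

theorem pairing_add_right (y : ω.obj D) (x x' : ω.obj P) :
    pairing ω y (x + x') = pairing ω y x + pairing ω y x' := by
  rw [pairing, fibreTmul_add, map_add]
  exact map_add (Functor.OplaxMonoidal.η ω).toLin _ _

theorem pairing_left_smul (a : A) (y : ω.obj D) (x : ω.obj P) :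
    pairing ω (a • y) x = a * pairing ω y x := by
  rw [pairing, ← left_smul_fibreTmul, toLin_left, fibreCounit_left_smul]; rfl

theorem pairing_right_smul (a : A) (y : ω.obj D) (x : ω.obj P) :
    pairing ω y (op a • x) = pairing ω y x * a := by
  rw [pairing, ← right_smul_fibreTmul, toLin_right, fibreCounit_right_smul]; rfl

theorem pairing_balanced (a : A) (y : ω.obj D) (x : ω.obj P) :
    pairing ω (op a • y) x = pairing ω y (a • x) := by
  rw [pairing, fibreTmul_balanced]; rfl

/-- The functional `⟨y, -⟩`, as an `A`-linear function of `y`. -/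
def pairingLeft : ω.obj D →ₗ[A] RDual (ω.obj P) where
  toFun y :=
    { toFun := pairing ω y
      map_add' := pairing_add_right ω y
      map_smul' := fun a x => pairing_right_smul ω (unop a) y x }
  map_add' y y' := LinearMap.ext fun x => pairing_add_left ω y y' x
  map_smul' a y := LinearMap.ext fun x => pairing_left_smul ω a y x

@[simp] theorem pairingLeft_apply (y : ω.obj D) (x : ω.obj P) :
    pairingLeft ω y x = pairing ω y x := rfl

end Basic

section Copairing

/-- Every element of `ω(P ⊗ Q)` is a finite sum of elements `x ⊗ y`. -/
theorem exists_sum_fibreTmul {P Q : C} (z : ω.obj (P ⊗ Q)) :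
    ∃ (n : ℕ) (x : Fin n → ω.obj P) (y : Fin n → ω.obj Q), z = ∑ i, fibreTmul ω (x i) (y i) := by
  induction z using fibreTmul_induction with
  | zero => exact ⟨0, Fin.elim0, Fin.elim0, by simp⟩
  | tmul x y => exact ⟨1, fun _ => x, fun _ => y, by simp⟩
  | add s t hs ht =>
    obtain ⟨n, x, y, rfl⟩ := hs
    obtain ⟨n', x', y', rfl⟩ := ht
    refine ⟨n + n', Fin.append x x', Fin.append y y', ?_⟩
    simp [Fin.sum_univ_add]

theorem sum_fibreTmul {P Q : C} {ι : Type*} (s : Finset ι) (x : ι → ω.obj P) (y : ω.obj Q) :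
    fibreTmul ω (∑ i ∈ s, x i) y = ∑ i ∈ s, fibreTmul ω (x i) y :=
  map_sum (AddMonoidHom.mk' (fibreTmul ω · y) (fun s t => add_fibreTmul ω s t y)) x s

theorem fibreTmul_sum {P Q : C} {ι : Type*} (s : Finset ι) (x : ω.obj P) (y : ι → ω.obj Q) :
    fibreTmul ω x (∑ i ∈ s, y i) = ∑ i ∈ s, fibreTmul ω x (y i) :=
  map_sum (AddMonoidHom.mk' (fibreTmul ω x) (fibreTmul_add ω x)) y s

/-- Families with `ω(coev)(1) = ∑ eᵢ ⊗ yᵢ`. -/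
def IsCopairing (P D : C) [ExactPairing P D] {n : ℕ} (e : Fin n → ω.obj P)
    (y : Fin n → ω.obj D) : Prop :=
  (ω.map (η_ P D)).toLin (fibreUnit ω 1) = ∑ i, fibreTmul ω (e i) (y i)

variable (P D : C) [ExactPairing P D]

theorem exists_isCopairing :
    ∃ (n : ℕ) (e : Fin n → ω.obj P) (y : Fin n → ω.obj D), IsCopairing ω P D e y :=
  exists_sum_fibreTmul ω _

variable {ω P D} {n : ℕ} {e : Fin n → ω.obj P} {y : Fin n → ω.obj D}

/-- The first triangle identity: the families `eᵢ` and `⟨yᵢ, -⟩` form a dual basis. -/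
theorem IsCopairing.isFiniteDualBasis (h : IsCopairing ω P D e y) :
    IsFiniteDualBasis (ω.obj P) e (fun i => pairingLeft ω (y i)) := fun x => by
  have h1 := congrArg (fun f => (ω.map (ρ_ P).hom).toLin
    ((ω.map f).toLin (fibreTmul ω (fibreUnit ω 1) x)))
    (ExactPairing.evaluation_coevaluation (C := C) (X := P) (Y := D))
  simp only [map_comp_toLin, map_whiskerRight_fibreTmul, map_leftUnitor_fibreTmul,
    map_hom_inv_toLin, one_smul] at h1
  rw [h] at h1
  simp only [sum_fibreTmul, map_sum, map_associator_fibreTmul, map_whiskerLeft_fibreTmul,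
    map_evaluation_fibreTmul, map_rightUnitor_fibreTmul] at h1
  exact h1

/-- The second triangle identity. -/
theorem IsCopairing.sum_pairing_smul (h : IsCopairing ω P D e y) (z : ω.obj D) :
    ∑ i, pairing ω z (e i) • y i = z := by
  have h1 := congrArg (fun f => (ω.map (λ_ D).hom).toLin
    ((ω.map f).toLin (fibreTmul ω z (fibreUnit ω 1))))
    (ExactPairing.coevaluation_evaluation (C := C) (X := P) (Y := D))
  simp only [map_comp_toLin, map_whiskerLeft_fibreTmul, map_rightUnitor_fibreTmul,
    map_hom_inv_toLin, op_one, one_smul] at h1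
  rw [h] at h1
  simp only [fibreTmul_sum, map_sum, map_associator_inv_fibreTmul, map_whiskerRight_fibreTmul,
    map_evaluation_fibreTmul, map_leftUnitor_fibreTmul] at h1
  exact h1

variable (ω P D)

theorem pairingLeft_bijective :
    Function.Bijective (pairingLeft ω : ω.obj D →ₗ[A] RDual (ω.obj P)) := by
  obtain ⟨n, e, y, h⟩ := exists_isCopairing ω P D
  constructor
  · intro z z' hz
    have h1 (x : ω.obj P) : pairing ω z x = pairing ω z' x := LinearMap.congr_fun hz x
    rw [← h.sum_pairing_smul z, ← h.sum_pairing_smul z']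
    simp only [h1]
  · intro φ
    refine ⟨∑ i, φ (e i) • y i, ?_⟩
    simp only [map_sum, map_smul]
    exact h.isFiniteDualBasis.sum_apply_smul LinearMap.id φ

/-- The isomorphism `γ : ω(P)* ≃ ω(D)` with `⟨γ φ, x⟩ = φ x`. -/
noncomputable def pairingEquiv : RDual (ω.obj P) ≃ₗ[A] ω.obj D :=
  (LinearEquiv.ofBijective (pairingLeft ω) (pairingLeft_bijective ω P D)).symm

variable {ω P D}

theorem pairing_pairingEquiv (φ : RDual (ω.obj P)) (x : ω.obj P) :
    pairing ω (pairingEquiv ω P D φ) x = φ x :=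
  LinearMap.congr_fun ((LinearEquiv.ofBijective (pairingLeft ω)
    (pairingLeft_bijective ω P D)).apply_symm_apply φ) x

theorem eq_of_pairing_eq {z z' : ω.obj D} (h : ∀ x : ω.obj P, pairing ω z x = pairing ω z' x) :
    z = z' :=
  (pairingLeft_bijective ω P D).1 (LinearMap.ext h)

end Copairing

section Examples

theorem pairing_unit (a b : A) :
    pairing ω (P := 𝟙_ C) (D := 𝟙_ C) (fibreUnit ω a) (fibreUnit ω b) = a * b := by
  have h : ε_ (𝟙_ C) (𝟙_ C) = (ρ_ (𝟙_ C)).hom := rfl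
  rw [pairing, h, map_rightUnitor_fibreTmul, right_smul_fibreUnit, fibreCounit_unit]

theorem pairing_tensor {P D Q E : C} [ExactPairing P D] [ExactPairing Q E] (z : ω.obj E)
    (y : ω.obj D) (p : ω.obj P) (q : ω.obj Q) :
    pairing ω (P := P ⊗ Q) (D := E ⊗ D) (fibreTmul ω z y) (fibreTmul ω p q) =
      pairing ω z (pairing ω y p • q) := by
  have h : ε_ (P ⊗ Q) (E ⊗ D) = (α_ E D (P ⊗ Q)).hom ≫ E ◁ (α_ D P Q).inv ≫
      E ◁ (ε_ P D ▷ Q) ≫ E ◁ (λ_ Q).hom ≫ ε_ Q E := by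
    rw [ExactPairing.tensor_evaluation]
    monoidal
  rw [pairing, h]
  simp only [map_comp_toLin, map_associator_fibreTmul, map_whiskerLeft_fibreTmul,
    map_associator_inv_fibreTmul, map_whiskerRight_fibreTmul, map_evaluation_fibreTmul,
    map_leftUnitor_fibreTmul, fibreCounit_unit]

theorem pairing_swap [BraidedCategory C] (hω : IsSymmetricFibre ω) {P D : C} [ExactPairing P D]
    (x : ω.obj P) (y : ω.obj D) :
    letI := BraidedCategory.exactPairing_swap P D
    pairing ω (P := D) (D := P) x y = pairing ω (P := P) (D := D) y x := by
  let _ := BraidedCategory.exactPairing_swap P D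
  have h : ε_ D P = (β_ P D).hom ≫ ε_ P D := rfl
  rw [pairing, h, map_comp_toLin, hω.braiding]
  rfl

/-- The pairing intertwines a morphism and its mate. -/
theorem pairing_mate {P D Q E : C} [i : ExactPairing P D] [j : ExactPairing Q E] (t : P ⟶ Q)
    (z : ω.obj E) (x : ω.obj P) :
    pairing ω ((ω.map (@rightAdjointMate C _ _ P Q ⟨D⟩ ⟨E⟩ t)).toLin z) x =
      pairing ω z ((ω.map t).toLin x) := by
  have h := congrArg (fun f => fibreCounit ω ((ω.map f).toLin (fibreTmul ω z x)))
    (@rightAdjointMate_comp_evaluation C _ _ P Q ⟨D⟩ ⟨E⟩ t)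
  simp only [map_comp_toLin] at h
  have h1 := map_whiskerRight_fibreTmul ω (@rightAdjointMate C _ _ P Q ⟨D⟩ ⟨E⟩ t) z x
  have h2 := map_whiskerLeft_fibreTmul ω t z x
  rw [pairing, pairing, ← h1, ← h2]
  exact h

end Examples

section Symmetric

variable {ω}
variable [BraidedCategory C] (hω : IsSymmetricFibre ω)
variable {P D : C} [ExactPairing P D]

/-- The functional `⟨-, x⟩`. -/
def pairingRight (x : ω.obj P) : RDual (ω.obj D) where
  toFun y := pairing ω y x
  map_add' y y' := pairing_add_left ω y y' x
  map_smul' a y := by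
    change pairing ω (op (unop a) • y) x = pairing ω y x * unop a
    rw [pairing_balanced, ← hω.central, pairing_right_smul]

@[simp] theorem pairingRight_apply (x : ω.obj P) (y : ω.obj D) :
    pairingRight hω x y = pairing ω y x := rfl

variable (hA : ∀ a b : A, a * b = b * a)

/-- The isomorphism `φ : ω(P) ≃ ω(D)*` with `φ(x)(y) = ⟨y, x⟩`. -/
noncomputable def pairingRightEquiv : ω.obj P ≃ₗ[A] RDual (ω.obj D) :=
  LinearEquiv.ofBijective
    ({ toFun := pairingRight hω
       map_add' := fun x x' => LinearMap.ext fun y => pairing_add_right ω y x x'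
       map_smul' := fun a x => LinearMap.ext fun y => by
        change pairing ω y (a • x) = a * pairing ω y x
        rw [← hω.central, pairing_right_smul, hA] } : ω.obj P →ₗ[A] RDual (ω.obj D)) (by
    obtain ⟨n, e, y, h⟩ := exists_isCopairing ω P D
    constructor
    · intro x x' hx
      have h1 (z : ω.obj D) : pairing ω z x = pairing ω z x' := LinearMap.congr_fun hx z
      rw [← h.isFiniteDualBasis x, ← h.isFiniteDualBasis x']
      simp only [pairingLeft_apply, h1]
    · intro ψ
      refine ⟨∑ i, op (ψ (y i)) • e i, LinearMap.ext fun z => ?_⟩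
      change pairing ω z (∑ i, op (ψ (y i)) • e i) = ψ z
      have h1 := map_sum (pairingLeft ω z) (fun i => op (ψ (y i)) • e i) Finset.univ
      simp only [pairingLeft_apply, pairing_right_smul] at h1
      rw [h1]
      conv_rhs => rw [← h.sum_pairing_smul z, map_sum]
      refine Finset.sum_congr rfl fun i _ => ?_
      rw [← hω.central, RDual.map_op_smul, hA])

end Symmetric

end Pairing

/-! ### The antipode -/

section Antipode

variable {K : Type w} {A : Type u} [CommRing K] [Ring A] [Algebra K A]
variable {C : Type u} [Category.{v} C] [MonoidalCategory C]
variable {ω : C ⥤ BimodCat.{w, u} K A} [ω.Monoidal]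

namespace ComatrixRing

section Mates

variable [BraidedCategory C] (hω : IsSymmetricFibre ω)

/-- If `d` and `z` are related by the mate of `t : P ⟶ Q`, then so are the classes in the components
at the duals of `P` and `Q`. For `t = 𝟙 P` this compares two duals of `P`. -/
theorem mk_pairingRight_eq {P D Q E : C} [ExactPairing P D] [ExactPairing Q E] (t : P ⟶ Q)
    (d : ω.obj D) (z : ω.obj E) (p : ω.obj P)
    (h : ∀ x, pairing ω d x = pairing ω z ((ω.map t).toLin x)) :
    mk ω E (pairingRight hω ((ω.map t).toLin p)) z = mk ω D (pairingRight hω p) d := by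
  symm
  refine mk_eq_of_map ω (@rightAdjointMate C _ _ P Q ⟨D⟩ ⟨E⟩ t) ?_ ?_
  · exact LinearMap.ext fun z' => pairing_mate ω t z' p
  · exact eq_of_pairing_eq (P := P) fun x => (pairing_mate ω t z x).trans (h x).symm

end Mates

variable [Preadditive C] [Linear K C] [ω.Linear K]
variable [BraidedCategory C] (hω : IsSymmetricFibre ω)

theorem mul_comm_of_symmetric (hA : ∀ a b : A, a * b = b * a) (hω : IsSymmetricFibre ω)
    (x y : ComatrixRing ω) : x * y = y * x := by
  induction x using ComatrixRing.induction with
  | zero => rw [mul_zero, zero_mul]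
  | add x x' hx hx' => rw [mul_add, add_mul, hx, hx']
  | mk P p' p =>
  induction y using ComatrixRing.induction with
  | zero => rw [mul_zero, zero_mul]
  | add y y' hy hy' => rw [mul_add, add_mul, hy, hy']
  | mk Q q' q =>
    rw [mk_mul_mk, mk_mul_mk]
    refine mk_eq_of_map ω (β_ P Q).hom (RDual.fibre_ext ω fun x y => ?_) (hω.braiding P Q p q)
    rw [LinearMap.comp_apply, rightLin_apply, hω.braiding, fibreStar_apply, fibreStar_apply,
      ← hω.central, ← hω.central, RDual.map_op_smul, RDual.map_op_smul, hA]

variable [RightRigidCategory C]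

/-- The antipode as an additive map. -/
noncomputable def antipodeHom : ComatrixRing ω →+ ComatrixRing ω :=
  liftAdd ω (fun P p' p => mk ω Pᘁ (pairingRight hω p) (pairingEquiv ω P Pᘁ p'))
    (fun P p' p'' p => by rw [map_add, mk_add])
    (fun P p' p p'' => by
      rw [← add_mk]
      congr 1
      exact LinearMap.ext fun y => pairing_add_right ω y p p'')
    (fun P Q t q' p => mk_pairingRight_eq hω t _ _ p fun x => by
      rw [pairing_pairingEquiv, pairing_pairingEquiv]; rfl)

/-- The antipode may be computed with any dual of `P`. -/
theorem antipodeHom_mk {P D : C} [ExactPairing P D] (p' : RDual (ω.obj P)) (p : ω.obj P)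
    (d : ω.obj D) (h : ∀ x, pairing ω d x = p' x) :
    antipodeHom hω (mk ω P p' p) = mk ω D (pairingRight hω p) d := by
  rw [antipodeHom, liftAdd_mk]
  have h1 := mk_pairingRight_eq hω (D := D) (E := Pᘁ) (𝟙 P) d (pairingEquiv ω P Pᘁ p') p fun x => by
    rw [map_id_toLin, pairing_pairingEquiv, h]
  rwa [map_id_toLin] at h1

theorem antipodeHom_base (hA : ∀ a b : A, a * b = b * a) (a b : A) :
    antipodeHom hω (base ω a b) = base ω b a := by
  rw [base, antipodeHom_mk hω (D := 𝟙_ C) (fibreLeftMul ω a) (fibreUnit ω b) (fibreUnit ω a)]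
  · rw [base]
    congr 1
    refine RDual.unit_ext ω ?_
    rw [pairingRight_apply, pairing_unit, fibreLeftMul_apply, fibreCounit_unit, hA]
  · intro x
    rw [fibreLeftMul_apply, ← fibreUnit_counit ω x, pairing_unit, fibreCounit_unit]

theorem antipodeHom_mul (hA : ∀ a b : A, a * b = b * a) (x y : ComatrixRing ω) :
    antipodeHom hω (x * y) = antipodeHom hω x * antipodeHom hω y := by
  induction x using ComatrixRing.induction with
  | zero => rw [zero_mul, map_zero, zero_mul]
  | add x x' hx hx' => rw [add_mul, map_add, map_add, add_mul, hx, hx']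
  | mk P p' p =>
  induction y using ComatrixRing.induction with
  | zero => rw [mul_zero, map_zero, mul_zero]
  | add y y' hy hy' => rw [mul_add, map_add, map_add, mul_add, hy, hy']
  | mk Q q' q =>
    let d := pairingEquiv ω P Pᘁ p'
    let z := pairingEquiv ω Q Qᘁ q'
    rw [antipodeHom_mk hω p' p d (pairing_pairingEquiv p'),
      antipodeHom_mk hω q' q z (pairing_pairingEquiv q'),
      mul_comm_of_symmetric hA hω (mk ω Pᘁ _ d), mk_mul_mk, mk_mul_mk,
      antipodeHom_mk hω (D := Pᘁ ⊗ Qᘁ) _ _ (fibreTmul ω d z)]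
    · congr 1
      refine RDual.fibre_ext ω fun x y => ?_
      rw [pairingRight_apply, pairing_tensor, fibreStar_apply, pairingRight_apply,
        pairingRight_apply, ← hω.central, pairing_right_smul, pairing_left_smul]
    · intro x
      have h : pairingLeft ω (P := Q ⊗ P) (fibreTmul ω d z) = fibreStar ω q' p' := by
        refine RDual.fibre_ext ω fun x y => ?_
        rw [pairingLeft_apply, pairing_tensor, fibreStar_apply, pairing_pairingEquiv,
          pairing_pairingEquiv]
      exact LinearMap.congr_fun h x

theorem antipodeHom_antipodeHom (x : ComatrixRing ω) :
    antipodeHom hω (antipodeHom hω x) = x := by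
  induction x using ComatrixRing.induction with
  | zero => rw [map_zero, map_zero]
  | add x y hx hy => rw [map_add, map_add, hx, hy]
  | mk P p' p =>
    let d := pairingEquiv ω P Pᘁ p'
    let _ := BraidedCategory.exactPairing_swap P Pᘁ
    rw [antipodeHom_mk hω p' p d (pairing_pairingEquiv p'),
      antipodeHom_mk hω (P := Pᘁ) (D := P) _ d p fun y => pairing_swap ω hω p y]
    congr 1
    ext x
    exact (pairing_swap ω hω x d).trans (pairing_pairingEquiv p' x)

variable [ω.Additive] [Fact (IsPenrose C)]

/-- The antipode. -/
noncomputable def antipode (hA : ∀ a b : A, a * b = b * a) :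
    ComatrixRing ω →ₐ[UnitEnd ω] ComatrixRing ω :=
  { antipodeHom hω with
    map_one' := antipodeHom_base hω hA 1 1
    map_mul' := antipodeHom_mul hω hA
    commutes' := fun t => by
      change antipodeHom hω (base ω _ 1) = base ω _ 1
      rw [antipodeHom_base hω hA, base_unitEnd] }

theorem antipode_apply (hA : ∀ a b : A, a * b = b * a) (x : ComatrixRing ω) :
    antipode hω hA x = antipodeHom hω x := rfl

variable (D : DualBases ω)

theorem mul_antipode (hA : ∀ a b : A, a * b = b * a) (v : ComatrixRing ω) {n : ℕ}
    (x y : Fin n → ComatrixRing ω) (hv : (comul D).toLin v = sumTmul (baseHom ω) x y) :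
    ∑ i, x i * antipodeHom hω (y i) = src (baseHom ω) (counitHom ω v) := by
  let f : Tensor (bimod ω) (bimod ω) →+ ComatrixRing ω :=
    Tensor.liftAdd (M := bimod ω) (N := bimod ω)
      (fun x y : ComatrixRing ω => x * antipodeHom hω y)
      (fun x x' y => add_mul (x : ComatrixRing ω) x' _)
      (fun x y y' => by
        change (x : ComatrixRing ω) * antipodeHom hω ((y : ComatrixRing ω) + y') = _
        rw [map_add, mul_add])
      (fun x a y => by
        change tgt (baseHom ω) a * (x : ComatrixRing ω) * antipodeHom hω y =
          x * antipodeHom hω (src (baseHom ω) a * y)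
        rw [antipodeHom_mul hω hA, src_baseHom, tgt_baseHom, antipodeHom_base hω hA, ← mul_assoc,
          mul_comm_of_symmetric hA hω x])
  have hf : f (comulHom D v) = ∑ i, x i * antipodeHom hω (y i) := by
    refine (congrArg f hv).trans ?_
    rw [sumTmul, map_sum]; rfl
  rw [← hf]
  refine DFunLike.congr_fun (addHom_ext (ω := ω) (f := f.comp (comulHom D))
    (g := (AddMonoidHom.mk' (src (baseHom ω)) fun a a' => by
      rw [src_baseHom, src_baseHom, src_baseHom, base_add_left]).comp (counitHom ω))
    fun P p' p => ?_) v
  obtain ⟨m, e, z, h⟩ := exists_isCopairing ω P Pᘁ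
  change f (comulHom D (mk ω P p' p)) = src (baseHom ω) (counitHom ω (mk ω P p' p))
  rw [comulHom_mk D h.isFiniteDualBasis, map_sum, counitHom_mk, src_baseHom]
  have h1 (i : Fin m) : f (Tensor.tmul (M := bimod ω) (N := bimod ω) (mk ω P p' (e i))
      (mk ω P (pairingLeft ω (z i)) p)) =
      mk ω (Pᘁ ⊗ P) (fibreStar ω (pairingRight hω p) p') (fibreTmul ω (z i) (e i)) := by
    change mk ω P p' (e i) * antipodeHom hω (mk ω P (pairingLeft ω (z i)) p) = _
    rw [antipodeHom_mk hω (D := Pᘁ) _ p (z i) fun x => rfl, mk_mul_mk]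
  rw [Finset.sum_congr rfl fun i _ => h1 i, ← mk_sum]
  -- The element `∑ zᵢ ⊗ eᵢ` is the image of `1` under the braided coevaluation.
  have h2 : (ω.map (η_ P Pᘁ ≫ (β_ P Pᘁ).hom)).toLin (fibreUnit ω 1) =
      ∑ i, fibreTmul ω (z i) (e i) := by
    rw [map_comp_toLin, h, map_sum]
    exact Finset.sum_congr rfl fun i _ => hω.braiding _ _ _ _
  refine mk_eq_of_map ω _ (RDual.unit_ext ω ?_) h2
  rw [LinearMap.comp_apply, rightLin_apply, h2, map_sum, fibreLeftMul_apply, fibreCounit_unit,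
    mul_one]
  simp only [fibreStar_apply, pairingRight_apply]
  rw [← map_sum]
  congr 1
  refine Eq.trans (Finset.sum_congr rfl fun i _ => ?_) (h.isFiniteDualBasis p)
  exact (hω.central _ _ _).symm

theorem antipode_mul (hA : ∀ a b : A, a * b = b * a) (v : ComatrixRing ω) {n : ℕ}
    (x y : Fin n → ComatrixRing ω) (hv : (comul D).toLin v = sumTmul (baseHom ω) x y) :
    ∑ i, antipodeHom hω (x i) * y i = tgt (baseHom ω) (counitHom ω v) := by
  let f : Tensor (bimod ω) (bimod ω) →+ ComatrixRing ω :=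
    Tensor.liftAdd (M := bimod ω) (N := bimod ω)
      (fun x y : ComatrixRing ω => antipodeHom hω x * y)
      (fun x x' y => by
        change antipodeHom hω ((x : ComatrixRing ω) + x') * (y : ComatrixRing ω) = _
        rw [map_add, add_mul])
      (fun x y y' => mul_add _ (y : ComatrixRing ω) y')
      (fun x a y => by
        change antipodeHom hω (tgt (baseHom ω) a * x) * (y : ComatrixRing ω) =
          antipodeHom hω x * (src (baseHom ω) a * y)
        rw [antipodeHom_mul hω hA, src_baseHom, tgt_baseHom, antipodeHom_base hω hA, ← mul_assoc,
          mul_comm_of_symmetric hA hω (base ω a 1)])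
  have hf : f (comulHom D v) = ∑ i, antipodeHom hω (x i) * y i := by
    refine (congrArg f hv).trans ?_
    rw [sumTmul, map_sum]; rfl
  rw [← hf]
  refine DFunLike.congr_fun (addHom_ext (ω := ω) (f := f.comp (comulHom D))
    (g := (AddMonoidHom.mk' (tgt (baseHom ω)) fun a a' => by
      rw [tgt_baseHom, tgt_baseHom, tgt_baseHom, base_add_right]).comp (counitHom ω))
    fun P p' p => ?_) v
  obtain ⟨m, e, z, h⟩ := exists_isCopairing ω P Pᘁ
  let d := pairingEquiv ω P Pᘁ p'
  change f (comulHom D (mk ω P p' p)) = tgt (baseHom ω) (counitHom ω (mk ω P p' p))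
  rw [comulHom_mk D h.isFiniteDualBasis, map_sum, counitHom_mk, tgt_baseHom]
  have h1 (i : Fin m) : f (Tensor.tmul (M := bimod ω) (N := bimod ω) (mk ω P p' (e i))
      (mk ω P (pairingLeft ω (z i)) p)) =
      mk ω (P ⊗ Pᘁ) (fibreStar ω (pairingLeft ω (z i)) (pairingRight hω (e i)))
        (fibreTmul ω p d) := by
    change antipodeHom hω (mk ω P p' (e i)) * mk ω P (pairingLeft ω (z i)) p = _
    rw [antipodeHom_mk hω (D := Pᘁ) p' (e i) d (pairing_pairingEquiv p'), mk_mul_mk]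
  rw [Finset.sum_congr rfl fun i _ => h1 i, ← sum_mk]
  -- The functional `∑ ⟨zᵢ, -⟩ ⋆ ⟨-, eᵢ⟩` is induced by the braided evaluation.
  have h2 (x : ω.obj P) (y : ω.obj Pᘁ) :
      (ω.map ((β_ P Pᘁ).hom ≫ ε_ P Pᘁ)).toLin (fibreTmul ω x y) =
        fibreUnit ω (pairing ω y x) := by
    rw [map_comp_toLin, hω.braiding, map_evaluation_fibreTmul]
  symm
  refine mk_eq_of_map ω ((β_ P Pᘁ).hom ≫ ε_ P Pᘁ) (RDual.fibre_ext ω fun x y => ?_) ?_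
  · rw [LinearMap.comp_apply, rightLin_apply, h2, fibreLeftMul_apply, fibreCounit_unit, one_mul,
      LinearMap.sum_apply]
    conv_lhs => rw [← h.isFiniteDualBasis x, ← pairingLeft_apply, map_sum]
    refine Finset.sum_congr rfl fun i _ => ?_
    rw [fibreStar_apply, pairingRight_apply, pairing_left_smul, pairingLeft_apply,
      pairing_right_smul, hA]
  · rw [h2, pairing_pairingEquiv]

theorem isCommHopfAlgebroid (hA : ∀ a b : A, a * b = b * a) :
    IsCommHopfAlgebroid (isTimesBialgebra D).leftBialgebroid (antipode hω hA) where
  base_comm := hA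
  total_comm := mul_comm_of_symmetric hA hω
  antipode_src a := by rw [antipode_apply, src_baseHom, tgt_baseHom, antipodeHom_base hω hA]
  antipode_tgt a := by rw [antipode_apply, src_baseHom, tgt_baseHom, antipodeHom_base hω hA]
  mul_antipode v _ x y hv := mul_antipode hω D hA v x y hv
  antipode_mul v _ x y hv := antipode_mul hω D hA v x y hv
  antipode_antipode := antipodeHom_antipodeHom hω

end ComatrixRing

end Antipode

open ComatrixRing in
theorem proposition2p2 {K : Type w} [CommRing K] {A : Type u} [Ring A] [Algebra K A]
    {C : Type u} [Category.{v} C] [Preadditive C] [Linear K C] [MonoidalCategory C]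
    [MonoidalPreadditive C] [MonoidalLinear K C]
    (ω : C ⥤ BimodCat.{w, u} K A) [ω.Additive] [ω.Linear K] [ω.Monoidal] [ω.Faithful]
    (hfgp : ∀ P : C, Module.Finite Aᵐᵒᵖ (ω.obj P) ∧ Module.Projective Aᵐᵒᵖ (ω.obj P))
    (hPenrose : IsPenrose C) :
    ∃ (V : Type u) (_ : Ring V) (_ : Algebra (UnitEnd ω) V)
      (η : A ⊗[UnitEnd ω] Aᵐᵒᵖ →ₐ[UnitEnd ω] V) (B : LeftBialgebroid η) (e : Comatrix ω ≃+ V),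
      -- the multiplication of `R(C)`
      (∀ (P Q : C) (p' : RDual (ω.obj P)) (p : ω.obj P) (q' : RDual (ω.obj Q)) (q : ω.obj Q),
        e (Comatrix.mk ω P p' p) * e (Comatrix.mk ω Q q' q) =
          e (Comatrix.mk ω (Q ⊗ P) (fibreStar ω q' p') (fibreTmul ω q p))) ∧
      -- the source and target maps
      (∀ a b : A, η (a ⊗ₜ op b) =
        e (Comatrix.mk ω (𝟙_ C) (leftMul K a ∘ₗ rightLin (Functor.OplaxMonoidal.η ω))
          ((Functor.LaxMonoidal.ε ω).toLin b))) ∧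
      -- the underlying bimodule, the comultiplication and the counit of the comatrix coring
      (∀ (P : C) (p' : RDual (ω.obj P)) (p : ω.obj P) (a b : A),
        η (a ⊗ₜ op b) * e (Comatrix.mk ω P p' p) = e (Comatrix.mk ω P (a • p') (op b • p))) ∧
      (∀ (P : C) (p' : RDual (ω.obj P)) (p : ω.obj P) (n : ℕ) (b : Fin n → ω.obj P)
        (b' : Fin n → RDual (ω.obj P)), IsDualBasis (ω.obj P) b b' →
        B.coring.comul.toLin (e (Comatrix.mk ω P p' p)) =
          sumTmul η (fun i => e (Comatrix.mk ω P p' (b i)))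
            (fun i => e (Comatrix.mk ω P (b' i) p))) ∧
      (∀ (P : C) (p' : RDual (ω.obj P)) (p : ω.obj P),
        B.coring.counit.toLin (e (Comatrix.mk ω P p' p)) = p' p) ∧
      -- the commutative case
      (∀ [SymmetricCategory C] [RigidCategory C], (∀ a b : A, a * b = b * a) →
        IsSymmetricFibre ω →
        ∃ (S : V →ₐ[UnitEnd ω] V) (φ : ∀ P : C, ω.obj P ≃ₗ[A] RDual (ω.obj Pᘁ))
          (γ : ∀ P : C, RDual (ω.obj P) ≃ₗ[A] ω.obj Pᘁ),
          IsCommHopfAlgebroid B S ∧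
          (∀ (P : C) (p : ω.obj P) (y : ω.obj Pᘁ), φ P p y = evalPairing ω P y p) ∧
          (∀ (P : C) (p' : RDual (ω.obj P)) (p : ω.obj P), evalPairing ω P (γ P p') p = p' p) ∧
          ∀ (P : C) (p' : RDual (ω.obj P)) (p : ω.obj P),
            S (e (Comatrix.mk ω P p' p)) = e (Comatrix.mk ω Pᘁ (φ P p) (γ P p'))) := by
  have : Fact (IsPenrose C) := ⟨hPenrose⟩
  have hbasis (P : C) : ∃ (n : ℕ) (b : Fin n → ω.obj P) (φ : Fin n → RDual (ω.obj P)),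
      IsFiniteDualBasis (ω.obj P) b φ := by
    have := (hfgp P).1
    have := (hfgp P).2
    exact exists_isFiniteDualBasis (ω.obj P)
  choose n b φ h using hbasis
  let D : DualBases ω := ⟨n, b, φ, h⟩
  refine ⟨ComatrixRing ω, inferInstance, inferInstance, baseHom ω,
    (isTimesBialgebra D).leftBialgebroid, AddEquiv.refl (ComatrixRing ω),
    fun P Q p' p q' q => mk_mul_mk ω P Q p' p q' q, baseHom_tmul ω, fun P p' p a b => ?_,
    fun P p' p n b b' hb => comul_mk D hb p' p, counit_mk, ?_⟩
  · rw [baseHom_tmul]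
    exact base_mul_mk ω a b P p' p
  · intro _ _ hA hω
    exact ⟨antipode hω hA, fun P => pairingRightEquiv hω hA, fun P => pairingEquiv ω P Pᘁ,
      isCommHopfAlgebroid hω D hA, fun P p y => rfl, fun P p' p => pairing_pairingEquiv p' p,
      fun P p' p => antipodeHom_mk hω p' p _ (pairing_pairingEquiv p')⟩
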